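/- Let $X$ be a Riemann surface (a connected Hausdorff complex manifold of complex dimension one, not assumed second countable), and let $K\subset X$ be a compact, simply-connected sub-surface with smooth boundary, such that the boundary $\partial K$ has precisely one connected component. (Here a sub-surface with smooth boundary is a subset $K$ such that near each of its points there is a real $C^\infty$ chart $e:U\to\mathbb{C}$ of $X$ with $K\cap U=\{x\in U:\operatorname{Im} e(x)\ge 0\}$; $\partial K$ and $\mathring K$ denote the topological boundary and interior of $K$ in $X$.) Then there exists a biholomorphism $\varphi:\mathring{K}\to\mathbb{D}$ from the interior of $K$ onto the open unit disk $\mathbb{D}=\{z\in\mathbb{C}:|z|<1\}$. -/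

import Mathlib

open scoped Manifold ContDiff

/-- `K` is a sub-surface with smooth boundary of the Riemann surface `X` (a smooth submanifold with
boundary of real codimension zero): around every point of `K` there is a real-smooth chart `e`
of `X`, i.e. a chart that is real-smoothly compatible with the holomorphic charts, in which `K` is
the closed upper half plane. The boundary of such a (closed) `K` is its topological frontier, and
the interior is its topological interior. -/
def IsSubsurfaceWithSmoothBoundary {X : Type*} [TopologicalSpace X] [ChartedSpace ℂ X]
    (K : Set X) : Prop :=
  ∀ p ∈ K, ∃ e ∈ IsManifold.maximalAtlas 𝓘(ℝ, ℂ) ∞ X,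
    p ∈ e.source ∧ ∀ x ∈ e.source, x ∈ K ↔ 0 ≤ (e x).im

/-- The interior of `K` as an open subset, with the complex structure induced from `X`. -/
def interiorSurface {X : Type*} [TopologicalSpace X] (K : Set X) : TopologicalSpace.Opens X :=
  ⟨interior K, isOpen_interior⟩

/-- The open unit disk in `ℂ`, with the complex structure induced from `ℂ`. -/
def openUnitDisk : TopologicalSpace.Opens ℂ :=
  ⟨Metric.ball 0 1, Metric.isOpen_ball⟩

/-! ### Harmonic functions on plane discs: Poisson integral, Dirichlet problem, Harnack, Perron's
lemma -/

open scoped Manifold ContDiff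
open Set Filter Topology Metric InnerProductSpace

/-! The biholomorphism is built from a Green's function. Pushing `K` inwards along its boundary
charts shows that `interior K` is homotopy equivalent to `K`, hence simply connected. For `p` in the
interior, Perron's method gives a function `u ≥ 0` that is harmonic off `p`, has a logarithmic pole
at `p` and tends to `0` at the boundary (`IsSubsurfaceWithSmoothBoundary.exists_green`). Locally `u
= Re F`; the functions `exp (-F)`, multiplied by a centred coordinate at `p`, differ by locally
constant unimodular factors. On a simply connected domain these can be removed
(`exists_coboundary_of_locally_constant_cocycle`), which leaves a holomorphic `f` with `|f| = exp
(-u)` off `p` and a single simple zero at `p`. It is proper to the disc because `u` tends to `0` at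
the boundary.

For injectivity, compare `f` with the Green map `h` of another point `q`. The Blaschke factor of `f`
that vanishes at `q` equals `Q * h` with `|Q| ≤ 1`, by a Schwarz lemma (`IsGreenMap.exists_factor`).
At `p` this reads `|f q| ≤ |h p|`; exchanging the roles of `p` and `q` gives equality. So `|Q|`
attains `1` at `p` and is identically `1`, and `f - f q` vanishes only at `q`, to first order. Thus
`f` is an injective immersion. Its image is open, and relatively closed in the disc by properness,
hence the whole disc.

Perron's method is run on directed families, with Harnack's inequality in place of sequences, so no
countability of `X` enters. The smooth boundary is used for barriers: a short segment leaves `K` at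
each boundary point, and the real part of a square root slit along it is a barrier. The Perron
family with a pole is bounded by comparing two concentric circles. -/

theorem continuousOn_poissonKernel_sphere {R : ℝ} {w : ℂ} (hw : w ∈ ball (0 : ℂ) R) :
    ContinuousOn (poissonKernel 0 w) (sphere 0 |R|) := by
  rw [poissonKernel_eq_re_herglotzRieszKernel]
  exact Complex.continuous_re.comp_continuousOn (continuousOn_herglotzRieszKernel_sphere hw)

theorem poissonKernel_nonneg {R : ℝ} {w ζ : ℂ} (hw : w ∈ ball (0 : ℂ) R)
    (hζ : ζ ∈ sphere (0 : ℂ) |R|) : 0 ≤ poissonKernel 0 w ζ := by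
  have hR : 0 < R := pos_of_mem_ball hw
  have h1 : ‖w‖ < R := by simpa using hw
  have h2 : ‖ζ‖ = R := by simpa [abs_of_pos hR] using hζ
  simp only [poissonKernel, sub_zero, h2]
  have := norm_nonneg w
  apply div_nonneg _ (by positivity)
  nlinarith

/-- The Poisson integral over the circle of radius `R` about the origin. -/
noncomputable def poissonIntegral (R : ℝ) (φ : ℂ → ℝ) (w : ℂ) : ℝ :=
  Real.circleAverage (poissonKernel 0 w • φ) 0 R

theorem circleIntegrable_poissonKernel_smul {R : ℝ} {w : ℂ} {φ : ℂ → ℝ}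
    (hw : w ∈ ball (0 : ℂ) R) (hφ : ContinuousOn φ (sphere 0 R)) :
    CircleIntegrable (poissonKernel 0 w • φ) 0 R := by
  have hR : 0 < R := pos_of_mem_ball hw
  exact ((continuousOn_poissonKernel_sphere hw).smul
    (by rwa [abs_of_pos hR])).circleIntegrable'

theorem poissonIntegral_eq {R : ℝ} {w : ℂ} {h : ℂ → ℝ} (hh : HarmonicContOnCl h (ball 0 R))
    (hw : w ∈ ball (0 : ℂ) R) : poissonIntegral R h w = h w :=
  hh.circleAverage_poissonKernel_smul hw

theorem poissonIntegral_mono {R : ℝ} {w : ℂ} {φ ψ : ℂ → ℝ} (hw : w ∈ ball (0 : ℂ) R)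
    (hφ : ContinuousOn φ (sphere 0 R)) (hψ : ContinuousOn ψ (sphere 0 R))
    (h : ∀ z ∈ sphere (0 : ℂ) R, φ z ≤ ψ z) : poissonIntegral R φ w ≤ poissonIntegral R ψ w := by
  have hR : 0 < R := pos_of_mem_ball hw
  refine Real.circleAverage_mono (circleIntegrable_poissonKernel_smul hw hφ)
    (circleIntegrable_poissonKernel_smul hw hψ) fun z hz ↦ ?_
  simp only [Pi.smul_apply', smul_eq_mul]
  exact mul_le_mul_of_nonneg_left (h z (by rwa [abs_of_pos hR] at hz)) (poissonKernel_nonneg hw hz)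

theorem harmonicContOnCl_of_analytic {F : ℂ → ℂ} (hF : Differentiable ℂ F) (s : Set ℂ) :
    HarmonicContOnCl (fun z ↦ (F z).re) s :=
  ⟨fun x _ ↦ (hF.analyticAt x).harmonicAt_re,
    (Complex.continuous_re.comp hF.continuous).continuousOn⟩

theorem poissonIntegral_const {R : ℝ} {w : ℂ} (c : ℝ) (hw : w ∈ ball (0 : ℂ) R) :
    poissonIntegral R (fun _ ↦ c) w = c := by
  have := harmonicContOnCl_of_analytic (F := fun _ ↦ (c : ℂ)) (by fun_prop) (ball 0 R)
  simpa using poissonIntegral_eq this hw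

theorem poissonIntegral_sub {R : ℝ} {w : ℂ} {φ ψ : ℂ → ℝ} (hw : w ∈ ball (0 : ℂ) R)
    (hφ : ContinuousOn φ (sphere 0 R)) (hψ : ContinuousOn ψ (sphere 0 R)) :
    poissonIntegral R (fun z ↦ φ z - ψ z) w = poissonIntegral R φ w - poissonIntegral R ψ w := by
  rw [poissonIntegral, poissonIntegral, poissonIntegral,
    ← Real.circleAverage_sub (circleIntegrable_poissonKernel_smul hw hφ)
    (circleIntegrable_poissonKernel_smul hw hψ)]
  congr 1
  ext z
  simp [mul_sub]

theorem abs_poissonIntegral_sub_le {R ε : ℝ} {w : ℂ} {φ ψ : ℂ → ℝ} (hw : w ∈ ball (0 : ℂ) R)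
    (hφ : ContinuousOn φ (sphere 0 R)) (hψ : ContinuousOn ψ (sphere 0 R))
    (h : ∀ z ∈ sphere (0 : ℂ) R, |φ z - ψ z| ≤ ε) :
    |poissonIntegral R φ w - poissonIntegral R ψ w| ≤ ε := by
  rw [← poissonIntegral_sub hw hφ hψ, abs_le]
  constructor
  · rw [← poissonIntegral_const (-ε) hw]
    exact poissonIntegral_mono hw continuousOn_const (hφ.sub hψ) fun z hz ↦ (abs_le.1 (h z hz)).1
  · rw [← poissonIntegral_const ε hw]
    exact poissonIntegral_mono hw (hφ.sub hψ) continuousOn_const fun z hz ↦ (abs_le.1 (h z hz)).2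

theorem harmonicOnNhd_poissonIntegral {R : ℝ} {φ : ℂ → ℝ} (hφ : ContinuousOn φ (sphere 0 R)) :
    HarmonicOnNhd (poissonIntegral R φ) (ball 0 R) := by
  intro w hw
  have hR : 0 < R := pos_of_mem_ball hw
  have hφ' : CircleIntegrable φ 0 R := (by rwa [abs_of_pos hR] :
    ContinuousOn φ (sphere 0 |R|)).circleIntegrable'
  have hφC : CircleIntegrable (fun z ↦ (φ z : ℂ)) 0 R :=
    (Complex.continuous_ofReal.comp_continuousOn (by rwa [abs_of_pos hR] :
      ContinuousOn φ (sphere 0 |R|))).circleIntegrable'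
  have := (analyticOnNhd_circleAverage_herglotzRieszKernel_smul hφC w hw).harmonicAt_re
  refine (harmonicAt_congr_nhds ?_).1 this
  filter_upwards [isOpen_ball.mem_nhds hw] with z hz
  rw [re_circleAverage_herglotzRieszKernel_smul hφ' hz, poissonIntegral,
    poissonKernel_eq_re_herglotzRieszKernel]

/-- The Poisson integral reproduces the harmonic approximants and does not increase the sup norm, so
the uniform limit is its own Poisson integral. -/
theorem harmonicContOnCl_of_approx {R : ℝ} (hR : 0 < R) {u : ℂ → ℝ}
    (h : ∀ ε > 0, ∃ g : ℂ → ℝ, HarmonicContOnCl g (ball 0 R) ∧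
      ∀ z ∈ closedBall (0 : ℂ) R, |u z - g z| ≤ ε) : HarmonicContOnCl u (ball 0 R) := by
  have hcl : closure (ball (0 : ℂ) R) = closedBall 0 R := closure_ball _ hR.ne'
  have hc : ContinuousOn u (closedBall 0 R) := by
    refine continuousOn_of_uniform_approx_of_continuousOn fun s hs ↦ ?_
    obtain ⟨ε, hε, hs⟩ := Metric.mem_uniformity_dist.1 hs
    obtain ⟨g, hg, hgu⟩ := h (ε / 2) (half_pos hε)
    refine ⟨g, hcl ▸ hg.continuousOn, fun z hz ↦ hs ?_⟩
    rw [Real.dist_eq]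
    linarith [hgu z hz]
  have hs : sphere (0 : ℂ) R ⊆ closedBall 0 R := sphere_subset_closedBall
  refine ⟨?_, hcl ▸ hc⟩
  have key : ∀ w ∈ ball (0 : ℂ) R, poissonIntegral R u w = u w := by
    intro w hw
    refine eq_of_abs_sub_le_all fun ε hε ↦ ?_
    obtain ⟨g, hg, hgu⟩ := h (ε / 2) (half_pos hε)
    have h1 := abs_poissonIntegral_sub_le hw (hc.mono hs)
      ((hcl ▸ hg.continuousOn : ContinuousOn g (closedBall 0 R)).mono hs)
      fun z hz ↦ hgu z (hs hz)
    rw [poissonIntegral_eq hg hw] at h1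
    have h2 := hgu w (ball_subset_closedBall hw)
    rw [abs_le] at *
    constructor <;> linarith [h1.1, h1.2, h2.1, h2.2]
  intro w hw
  refine (harmonicAt_congr_nhds ?_).1 (harmonicOnNhd_poissonIntegral (hc.mono hs) w hw)
  filter_upwards [isOpen_ball.mem_nhds hw] with z hz using key z hz

/-- On the circle a negative power is the conjugate of a positive one. Since `F + conj G` and `F +
G` have the same real part, real parts of trigonometric polynomials extend to real parts of entire
functions. -/
theorem exists_entire_of_mem_span_fourier {g : C(AddCircle (2 * Real.pi), ℂ)}
    (hg : g ∈ Submodule.span ℂ (range (@fourier (2 * Real.pi)))) :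
    ∃ F G : ℂ → ℂ, Differentiable ℂ F ∧ Differentiable ℂ G ∧
      ∀ θ, g θ = F (AddCircle.toCircle θ) + (starRingEnd ℂ) (G (AddCircle.toCircle θ)) := by
  induction hg using Submodule.span_induction with
  | mem x hx =>
    obtain ⟨n, rfl⟩ := hx
    obtain ⟨m, rfl | rfl⟩ := n.eq_nat_or_neg
    · refine ⟨fun z ↦ z ^ m, 0, by fun_prop, by fun_prop, fun θ ↦ ?_⟩
      simp [fourier_apply, AddCircle.toCircle_nsmul]
    · refine ⟨0, fun z ↦ z ^ m, by fun_prop, by fun_prop, fun θ ↦ ?_⟩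
      simp [fourier_apply, AddCircle.toCircle_nsmul, AddCircle.toCircle_neg,
        ← Circle.coe_inv_eq_conj]
  | zero => exact ⟨0, 0, by fun_prop, by fun_prop, by simp⟩
  | add x y _ _ hx hy =>
    obtain ⟨F, G, hF, hG, h⟩ := hx
    obtain ⟨F', G', hF', hG', h'⟩ := hy
    refine ⟨F + F', G + G', hF.add hF', hG.add hG', fun θ ↦ ?_⟩
    simp [h, h']
    ring
  | smul c x _ hx =>
    obtain ⟨F, G, hF, hG, h⟩ := hx
    refine ⟨fun z ↦ c * F z, fun z ↦ (starRingEnd ℂ) c * G z, by fun_prop, by fun_prop,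
      fun θ ↦ ?_⟩
    simp [h]
    ring

theorem exists_entire_approx_on_sphere {R : ℝ} (hR : 0 < R) {φ : ℂ → ℝ}
    (hφ : ContinuousOn φ (sphere 0 R)) {ε : ℝ} (hε : 0 < ε) :
    ∃ F : ℂ → ℂ, Differentiable ℂ F ∧ ∀ z ∈ sphere (0 : ℂ) R, |φ z - (F z).re| ≤ ε := by
  have : Fact (0 < 2 * Real.pi) := ⟨Real.two_pi_pos⟩
  have hmem : ∀ θ : AddCircle (2 * Real.pi),
      (R : ℂ) * (AddCircle.toCircle θ : ℂ) ∈ sphere (0 : ℂ) R := by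
    intro θ; simp [abs_of_pos hR, Circle.norm_coe]
  let ψ : C(AddCircle (2 * Real.pi), ℂ) :=
    ⟨fun θ ↦ (φ (R * (AddCircle.toCircle θ : ℂ)) : ℂ), by
      refine Complex.continuous_ofReal.comp (hφ.comp_continuous ?_ hmem)
      exact continuous_const.mul (continuous_subtype_val.comp AddCircle.continuous_toCircle)⟩
  have hψ : ψ ∈ (Submodule.span ℂ (range (@fourier (2 * Real.pi)))).topologicalClosure := by
    rw [span_fourier_closure_eq_top]; trivial
  obtain ⟨g, hg, hgψ⟩ := Metric.mem_closure_iff.1 hψ ε hε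
  obtain ⟨F, G, hF, hG, h⟩ := exists_entire_of_mem_span_fourier hg
  refine ⟨fun z ↦ F (z / R) + G (z / R), by fun_prop, fun z hz ↦ ?_⟩
  have hz' : z / R ∈ sphere (0 : ℂ) 1 := by
    have : ‖z‖ = R := by simpa using hz
    simp [this, abs_of_pos hR, hR.ne']
  obtain ⟨θ, hθ⟩ : ∃ θ : AddCircle (2 * Real.pi), (AddCircle.toCircle θ : ℂ) = z / R := by
    refine ⟨((Complex.arg (z / R) : ℝ) : AddCircle (2 * Real.pi)), ?_⟩
    have h1 : ‖z / (R : ℂ)‖ = 1 := by simpa using hz'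
    have := Complex.norm_mul_exp_arg_mul_I (z / R)
    rw [h1] at this
    simp only [Complex.ofReal_one, one_mul] at this
    rw [AddCircle.toCircle_apply_mk, Circle.coe_exp]
    simpa using this
  have h2 := (ContinuousMap.dist_apply_le_dist θ).trans hgψ.le
  rw [h θ, hθ] at h2
  have h3 : ψ θ = (φ z : ℂ) := by
    have : (R : ℂ) ≠ 0 := by exact_mod_cast hR.ne'
    simp only [ψ, ContinuousMap.coe_mk, hθ]
    rw [mul_div_cancel₀ _ this]
  rw [h3, Complex.dist_eq] at h2
  have h4 := (Complex.abs_re_le_norm _).trans h2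
  simpa using h4

/-- The Dirichlet problem on a disc with continuous boundary values. -/
theorem exists_harmonicContOnCl_eqOn_sphere {R : ℝ} (hR : 0 < R) {φ : ℂ → ℝ}
    (hφ : ContinuousOn φ (sphere 0 R)) :
    ∃ H : ℂ → ℝ, HarmonicContOnCl H (ball 0 R) ∧ ∀ z ∈ sphere (0 : ℂ) R, H z = φ z := by
  classical
  -- Continuity up to the circle comes from uniform approximation by real parts of entire functions,
  -- so the kernel need not be estimated near the circle.
  refine ⟨fun w ↦ if w ∈ ball (0 : ℂ) R then poissonIntegral R φ w else φ w,
    harmonicContOnCl_of_approx hR fun ε hε ↦ ?_, fun z hz ↦ if_neg ?_⟩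
  · obtain ⟨F, hF, h⟩ := exists_entire_approx_on_sphere hR hφ hε
    have hg := harmonicContOnCl_of_analytic hF (ball 0 R)
    refine ⟨_, hg, fun z hz ↦ ?_⟩
    split_ifs with hzb
    · rw [← poissonIntegral_eq hg hzb]
      exact abs_poissonIntegral_sub_le hzb hφ
        (Complex.continuous_re.comp hF.continuous).continuousOn h
    · refine h z ?_
      simp only [mem_ball, mem_closedBall, mem_sphere, not_lt] at *
      exact le_antisymm hz hzb
  · simp only [mem_ball, mem_sphere, not_lt] at *
    exact hz.ge

theorem poissonKernel_le {R : ℝ} {w ζ : ℂ} (hw : w ∈ ball (0 : ℂ) R)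
    (hζ : ζ ∈ sphere (0 : ℂ) R) : poissonKernel 0 w ζ ≤ (R + ‖w‖) / (R - ‖w‖) := by
  have := re_herglotzRieszKernel_le hζ hw
  rw [poissonKernel_eq_re_herglotzRieszKernel]
  simpa [herglotzRieszKernel_def] using this

/-- **Harnack's inequality** for nonnegative harmonic functions on a disc. -/
theorem InnerProductSpace.HarmonicContOnCl.le_mul_of_nonneg {R : ℝ} {w : ℂ} {h : ℂ → ℝ}
    (hh : HarmonicContOnCl h (ball 0 R)) (h0 : ∀ z ∈ closedBall (0 : ℂ) R, 0 ≤ h z)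
    (hw : w ∈ ball (0 : ℂ) R) : h w ≤ (R + ‖w‖) / (R - ‖w‖) * h 0 := by
  have hR : 0 < R := pos_of_mem_ball hw
  have hcl : closure (ball (0 : ℂ) R) = closedBall 0 R := closure_ball _ hR.ne'
  have hc : ContinuousOn h (sphere 0 |R|) := by
    rw [abs_of_pos hR]
    exact (hcl ▸ hh.continuousOn : ContinuousOn h (closedBall 0 R)).mono sphere_subset_closedBall
  have hav : Real.circleAverage h 0 R = h 0 :=
    InnerProductSpace.HarmonicContOnCl.circleAverage_eq (by rwa [abs_of_pos hR])
  rw [← hav, ← poissonIntegral_eq hh hw, ← smul_eq_mul, ← Real.circleAverage_smul]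
  refine Real.circleAverage_mono (circleIntegrable_poissonKernel_smul hw
    (by rwa [abs_of_pos hR] at hc)) (hc.const_smul _).circleIntegrable' fun z hz ↦ ?_
  rw [abs_of_pos hR] at hz
  simp only [Pi.smul_apply', Pi.smul_apply, smul_eq_mul]
  exact mul_le_mul_of_nonneg_right (poissonKernel_le hw hz) (h0 z (sphere_subset_closedBall hz))

/-- **Perron's lemma** on a disc. -/
theorem harmonicOnNhd_iSup_of_directed {R : ℝ} {ι : Type*} [Nonempty ι] {f : ι → ℂ → ℝ}
    (hdir : ∀ i j, ∃ k, ∀ z ∈ closedBall (0 : ℂ) R, f i z ≤ f k z ∧ f j z ≤ f k z)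
    (hharm : ∀ i, ∃ k, HarmonicContOnCl (f k) (ball 0 R) ∧
      ∀ z ∈ closedBall (0 : ℂ) R, f i z ≤ f k z)
    (hbdd : ∀ z ∈ ball (0 : ℂ) R, BddAbove (range fun i ↦ f i z)) :
    HarmonicOnNhd (fun z ↦ ⨆ i, f i z) (ball 0 R) := by
  intro w hw
  have hR : 0 < R := pos_of_mem_ball hw
  obtain ⟨ρ, hwρ, hρR⟩ := exists_between (by simpa using hw : ‖w‖ < R)
  have hρ : 0 < ρ := (norm_nonneg w).trans_lt hwρ
  set u : ℂ → ℝ := fun z ↦ ⨆ i, f i z with hu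
  set C := (R + ρ) / (R - ρ) with hC
  have hCpos : 0 < C := div_pos (by linarith) (by linarith)
  refine (harmonicContOnCl_of_approx (u := u) hρ fun ε hε ↦ ?_).harmonicOnNhd w (by simpa using hwρ)
  -- Near-maximality is needed only at the centre: Harnack's constant `C` for radius `ρ` turns a
  -- defect `ε / C` there into `ε` on the smaller disc.
  obtain ⟨i, hsε⟩ := exists_lt_of_lt_ciSup
    (show u 0 - ε / C < ⨆ i, f i 0 from sub_lt_self _ (by positivity))
  obtain ⟨h, hh, hsh⟩ := hharm i
  have hsub : closedBall (0 : ℂ) ρ ⊆ ball 0 R := closedBall_subset_ball hρR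
  refine ⟨f h, ⟨hh.harmonicOnNhd.mono (ball_subset_ball hρR.le),
    hh.continuousOn.mono (closure_mono (ball_subset_ball hρR.le))⟩, fun z hz ↦ ?_⟩
  have hzR := hsub hz
  have hle : f h z ≤ u z := le_ciSup (hbdd z hzR) h
  rw [abs_of_nonneg (by linarith), sub_le_iff_le_add]
  refine ciSup_le fun t ↦ ?_
  -- The harmonic member `f k` will dominate both `f h` and `f t`, which makes `f k - f h`
  -- nonnegative and harmonic, as Harnack requires.
  obtain ⟨r, hrr⟩ := hdir h t
  obtain ⟨k, hk, hrk⟩ := hharm r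
  have h0R : (0 : ℂ) ∈ ball (0 : ℂ) R := mem_ball_self hR
  have hd : HarmonicContOnCl (f k - f h) (ball 0 R) :=
    ⟨fun x hx ↦ (hk.harmonicOnNhd x hx).sub (hh.harmonicOnNhd x hx),
      hk.continuousOn.sub hh.continuousOn⟩
  have hH := hd.le_mul_of_nonneg (fun y hy ↦ by
    have := (hrr y hy).1.trans (hrk y hy)
    simpa using this) hzR
  have h1 : f k 0 ≤ u 0 := le_ciSup (hbdd 0 h0R) k
  have h2 := hsh 0 (ball_subset_closedBall h0R)
  have h3 := (hrr z (ball_subset_closedBall hzR)).2.trans (hrk z (ball_subset_closedBall hzR))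
  have hzρ : ‖z‖ ≤ ρ := by simpa using hz
  have h4 : (R + ‖z‖) / (R - ‖z‖) ≤ C :=
    div_le_div₀ (by linarith) (by linarith) (by linarith) (by linarith)
  have h5 : (f k - f h) 0 ≤ ε / C := by simp only [Pi.sub_apply]; linarith
  have h6 : 0 ≤ (f k - f h) 0 := by
    have := ((hrr 0 (ball_subset_closedBall h0R)).1).trans (hrk 0 (ball_subset_closedBall h0R))
    simpa using this
  have h7 : (f k - f h) z ≤ ε := calc
    _ ≤ _ := hH
    _ ≤ C * (ε / C) := mul_le_mul h4 h5 h6 hCpos.le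
    _ = ε := by field_simp
  simp only [Pi.sub_apply] at h7
  linarith

/-! ### Harmonic and subharmonic functions on a Riemann surface -/

section Harmonic

variable {X : Type*} [TopologicalSpace X] [ChartedSpace ℂ X]

/-- `u` is the real part of a holomorphic function near `x`. -/
def HarmAt (u : X → ℝ) (x : X) : Prop :=
  ∃ F : X → ℂ, (∀ᶠ y in 𝓝 x, MDifferentiableAt 𝓘(ℂ) 𝓘(ℂ) F y) ∧ ∀ᶠ y in 𝓝 x, u y = (F y).re

/-- `v` is subharmonic at `x`: subtracting a harmonic function never creates a strict
local maximum at `x`. -/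
def SubAt (v : X → ℝ) (x : X) : Prop :=
  ∀ h : X → ℝ, HarmAt h x → IsLocalMax (fun y ↦ v y - h y) x →
    ∀ᶠ y in 𝓝 x, v y - h y = v x - h x

theorem HarmAt.congr {u v : X → ℝ} {x : X} (h : HarmAt u x) (huv : ∀ᶠ y in 𝓝 x, v y = u y) :
    HarmAt v x := by
  obtain ⟨F, hF, hu⟩ := h
  exact ⟨F, hF, by filter_upwards [hu, huv] with y h1 h2 using h2.trans h1⟩

theorem harmAt_const (c : ℝ) (x : X) : HarmAt (fun _ ↦ c) x :=
  ⟨fun _ ↦ (c : ℂ), .of_forall fun _ ↦ mdifferentiableAt_const, by simp⟩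

theorem HarmAt.add {u v : X → ℝ} {x : X} (hu : HarmAt u x) (hv : HarmAt v x) :
    HarmAt (fun y ↦ u y + v y) x := by
  obtain ⟨F, hF, hu⟩ := hu
  obtain ⟨G, hG, hv⟩ := hv
  refine ⟨F + G, ?_, ?_⟩
  · filter_upwards [hF, hG] with y h1 h2 using h1.add h2
  · filter_upwards [hu, hv] with y h1 h2
    simp [h1, h2]

theorem HarmAt.neg {u : X → ℝ} {x : X} (hu : HarmAt u x) : HarmAt (fun y ↦ - u y) x := by
  obtain ⟨F, hF, hu⟩ := hu
  refine ⟨-F, ?_, ?_⟩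
  · filter_upwards [hF] with y h1 using h1.neg
  · filter_upwards [hu] with y h1
    simp [h1]

theorem HarmAt.sub {u v : X → ℝ} {x : X} (hu : HarmAt u x) (hv : HarmAt v x) :
    HarmAt (fun y ↦ u y - v y) x := by
  simpa only [sub_eq_add_neg] using hu.add hv.neg

theorem HarmAt.continuousAt {u : X → ℝ} {x : X} (hu : HarmAt u x) : ContinuousAt u x := by
  obtain ⟨F, hF, hu⟩ := hu
  exact (Complex.continuous_re.continuousAt.comp hF.self_of_nhds.continuousAt).congr
    (by filter_upwards [hu] with y h using h.symm)

/-- Dividing by `f x` moves the values close to `1`, where the principal logarithm is holomorphic.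
-/
theorem harmAt_log_norm {f : X → ℂ} {x : X}
    (hf : ∀ᶠ y in 𝓝 x, MDifferentiableAt 𝓘(ℂ) 𝓘(ℂ) f y) (hx : f x ≠ 0) :
    HarmAt (fun y ↦ Real.log ‖f y‖) x := by
  have hc : ContinuousAt f x := hf.self_of_nhds.continuousAt
  have h1 : ∀ᶠ y in 𝓝 x, f y / f x ∈ Complex.slitPlane := by
    refine (hc.div_const (f x)).eventually (Complex.isOpen_slitPlane.mem_nhds ?_)
    simp [div_self hx]
  refine ⟨fun y ↦ Complex.log (f y / f x) + Real.log ‖f x‖, ?_, ?_⟩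
  · filter_upwards [hf, h1] with y h2 h3
    refine DifferentiableAt.comp_mdifferentiableAt
      (g := fun w ↦ Complex.log (w / f x) + Real.log ‖f x‖) ?_ h2
    exact ((Complex.differentiableAt_log h3).comp (f y)
      (f := fun w ↦ w / f x) (differentiableAt_id.div_const _)).add_const _
  · filter_upwards [h1] with y h3
    have hy : f y ≠ 0 := by
      rintro h
      simp [h] at h3
    simp only [Complex.add_re, Complex.log_re, Complex.ofReal_re, norm_div]
    rw [Real.log_div (norm_ne_zero_iff.2 hy) (norm_ne_zero_iff.2 hx)]
    ring

theorem SubAt.congr {u v : X → ℝ} {x : X} (h : SubAt u x) (huv : ∀ᶠ y in 𝓝 x, v y = u y) :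
    SubAt v x := by
  intro k hk hmax
  have hx := huv.self_of_nhds
  have : IsLocalMax (fun y ↦ u y - k y) x := by
    filter_upwards [hmax, huv] with y h1 h2
    simpa [← h2, ← hx] using h1
  filter_upwards [h k hk this, huv] with y h1 h2
  rw [h2, hx, h1]

theorem SubAt.add_harm {v u : X → ℝ} {x : X} (hv : SubAt v x) (hu : HarmAt u x) :
    SubAt (fun y ↦ v y + u y) x := by
  intro k hk hmax
  have := hv (fun y ↦ k y - u y) (hk.sub hu) (by
    convert hmax using 2
    ring)
  filter_upwards [this] with y h
  linarith

/-- A harmonic test function for `w` at `x` is also one for `v`. This one-point comparison handles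
maxima and Poisson modifications without sub-mean-value inequalities. -/
theorem SubAt.of_le {v w : X → ℝ} {x : X} (hv : SubAt v x) (hx : w x = v x)
    (hvw : ∀ᶠ y in 𝓝 x, v y ≤ w y) : SubAt w x := by
  intro k hk hmax
  have : IsLocalMax (fun y ↦ v y - k y) x := by
    filter_upwards [hmax, hvw] with y h1 h2
    linarith
  filter_upwards [hv k hk this, hmax, hvw] with y h1 h2 h3
  linarith

theorem SubAt.max {v w : X → ℝ} {x : X} (hv : SubAt v x) (hw : SubAt w x) :
    SubAt (fun y ↦ max (v y) (w y)) x := by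
  rcases le_total (w x) (v x) with h | h
  · exact hv.of_le (max_eq_left h) (.of_forall fun y ↦ le_max_left _ _)
  · exact hw.of_le (max_eq_right h) (.of_forall fun y ↦ le_max_right _ _)

/-- The maximum principle for subharmonic functions on a compact set. -/
theorem le_of_subAt [PreconnectedSpace X] [T2Space X] {L V : Set X} {s : X → ℝ} {m : ℝ}
    (hL : IsCompact L) (hV : IsOpen V) (hVL : V ⊆ L) (hVu : V ≠ univ)
    (hc : ContinuousOn s L) (hs : ∀ x ∈ V, SubAt s x) (hm : ∀ x ∈ L, x ∉ V → s x ≤ m) :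
    ∀ x ∈ L, s x ≤ m := by
  intro x hx
  obtain ⟨x₀, hx₀, hmax⟩ := hL.exists_isMaxOn ⟨x, hx⟩ hc
  refine (hmax hx).trans ?_
  by_contra! hlt
  -- If the maximum exceeded `m`, the set `A` where it is attained would lie in `V` and be both open
  -- and closed. Connectedness of `X`, not of `V`, then gives the contradiction.
  set A := {y ∈ L | s y = s x₀} with hA
  have hAV : A ⊆ V := fun y hy ↦ by
    by_contra hyV
    have := hm y hy.1 hyV
    rw [hy.2] at this
    exact absurd hlt (not_lt.2 this)
  have hAo : IsOpen A := by
    refine isOpen_iff_mem_nhds.2 fun y hy ↦ ?_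
    have hyV := hAV hy
    have hloc : IsLocalMax (fun z ↦ s z - (fun _ ↦ (0 : ℝ)) z) y := by
      filter_upwards [hV.mem_nhds hyV] with z hz
      simpa [hy.2] using hmax (hVL hz)
    filter_upwards [hs y hyV _ (harmAt_const 0 y) hloc, hV.mem_nhds hyV] with z h1 h2
    refine ⟨hVL h2, ?_⟩
    simpa [hy.2] using h1
  have hAc : IsClosed A := by
    have := hc.preimage_isClosed_of_isClosed hL.isClosed (isClosed_singleton (x := s x₀))
    exact this
  have hAu : A = univ := (isClopen_iff.1 ⟨hAc, hAo⟩).resolve_left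
    (Set.Nonempty.ne_empty ⟨x₀, hx₀, rfl⟩)
  exact hVu (univ_subset_iff.1 (hAu ▸ hAV))

variable [IsManifold 𝓘(ℂ) ω X]

/-- The strong maximum principle for harmonic functions. -/
theorem HarmAt.eventually_eq_of_isLocalMax {u : X → ℝ} {x : X} (hu : HarmAt u x)
    (hmax : IsLocalMax u x) : ∀ᶠ y in 𝓝 x, u y = u x := by
  obtain ⟨F, hF, hu⟩ := hu
  have hx := hu.self_of_nhds
  have h1 : ∀ᶠ y in 𝓝 x, MDifferentiableAt 𝓘(ℂ) 𝓘(ℂ) (fun y ↦ Complex.exp (F y)) y := by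
    filter_upwards [hF] with y hy
    exact Complex.differentiable_exp.differentiableAt.comp_mdifferentiableAt hy
  have h2 : IsLocalMax (norm ∘ fun y ↦ Complex.exp (F y)) x := by
    filter_upwards [hmax, hu] with y h1 h2
    simpa [Complex.norm_exp, ← h2, ← hx] using h1
  filter_upwards [Complex.norm_eventually_eq_of_mdifferentiableAt_of_isLocalMax h1 h2, hu]
    with y h3 h4
  simpa [Complex.norm_exp, ← h4, ← hx] using h3

theorem HarmAt.subAt {u : X → ℝ} {x : X} (hu : HarmAt u x) : SubAt u x :=
  fun _ hk hmax ↦ (hu.sub hk).eventually_eq_of_isLocalMax hmax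

end Harmonic

/-! ### Centred charts and coordinate discs -/

section Coordinates

variable {X : Type*} [TopologicalSpace X] [ChartedSpace ℂ X]

/-- The chart at `p`, centred at `p`. -/
noncomputable def crd (p : X) :
    OpenPartialHomeomorph X ℂ :=
  (chartAt ℂ p).transHomeomorph (Homeomorph.addRight (-(chartAt ℂ p p)))

theorem crd_self (p : X) : crd p p = 0 := by simp [crd]

theorem mem_crd_source (p : X) : p ∈ (crd p).source := by simp [crd]

theorem crd_symm_zero (p : X) : (crd p).symm 0 = p := by
  rw [← crd_self p, (crd p).left_inv (mem_crd_source p)]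

theorem crd_eq_zero_iff {p x : X} (hx : x ∈ (crd p).source) : crd p x = 0 ↔ x = p := by
  rw [← crd_self p]
  exact (crd p).injOn.eq_iff hx (mem_crd_source p)

theorem zero_mem_crd_target (p : X) : (0 : ℂ) ∈ (crd p).target := by
  rw [← crd_self p]; exact (crd p).map_source (mem_crd_source p)

theorem mdifferentiableAt_crd [IsManifold 𝓘(ℂ) ω X] {p x : X} (hx : x ∈ (crd p).source) :
    MDifferentiableAt 𝓘(ℂ) 𝓘(ℂ) (crd p) x := by
  have h := mdifferentiableAt_atlas (I := 𝓘(ℂ)) (chart_mem_atlas ℂ p) (x := x)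
    (by simpa [crd] using hx)
  exact DifferentiableAt.comp_mdifferentiableAt (g := fun w ↦ w + -(chartAt ℂ p p))
    (by fun_prop) h

theorem mdifferentiableAt_crd_symm [IsManifold 𝓘(ℂ) ω X] {p : X} {z : ℂ}
    (hz : z ∈ (crd p).target) : MDifferentiableAt 𝓘(ℂ) 𝓘(ℂ) (crd p).symm z := by
  have hz' : z + chartAt ℂ p p ∈ (chartAt ℂ p).target := by
    simpa [crd, Homeomorph.addRight, Equiv.addRight] using hz
  have h := mdifferentiableAt_atlas_symm (I := 𝓘(ℂ)) (chart_mem_atlas ℂ p) hz'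
  have h2 : MDifferentiableAt 𝓘(ℂ) 𝓘(ℂ) (fun w : ℂ ↦ w + chartAt ℂ p p) z :=
    (by fun_prop : DifferentiableAt ℂ (fun w : ℂ ↦ w + chartAt ℂ p p) z).mdifferentiableAt
  have := MDifferentiableAt.comp z h h2
  convert this using 1
  ext w
  simp [crd, Homeomorph.addRight, Equiv.addRight]

/-- The closed coordinate disc of radius `ρ` about `p`. -/
def cdisc (p : X) (ρ : ℝ) : Set X := (crd p).symm '' closedBall 0 ρ

/-- The open coordinate disc of radius `ρ` about `p`. -/
def odisc (p : X) (ρ : ℝ) : Set X := (crd p).symm '' ball 0 ρ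

theorem mem_cdisc {p : X} {ρ : ℝ} (h : closedBall 0 ρ ⊆ (crd p).target) {x : X} :
    x ∈ cdisc p ρ ↔ x ∈ (crd p).source ∧ ‖crd p x‖ ≤ ρ := by
  constructor
  · rintro ⟨z, hz, rfl⟩
    exact ⟨(crd p).map_target (h hz), by simpa [(crd p).right_inv (h hz)] using hz⟩
  · rintro ⟨h1, h2⟩
    exact ⟨crd p x, by simpa using h2, (crd p).left_inv h1⟩

theorem mem_odisc {p : X} {ρ : ℝ} (h : closedBall 0 ρ ⊆ (crd p).target) {x : X} :
    x ∈ odisc p ρ ↔ x ∈ (crd p).source ∧ ‖crd p x‖ < ρ := by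
  constructor
  · rintro ⟨z, hz, rfl⟩
    have := h (ball_subset_closedBall hz)
    exact ⟨(crd p).map_target this, by simpa [(crd p).right_inv this] using hz⟩
  · rintro ⟨h1, h2⟩
    exact ⟨crd p x, by simpa using h2, (crd p).left_inv h1⟩

theorem isCompact_cdisc {p : X} {ρ : ℝ} (h : closedBall 0 ρ ⊆ (crd p).target) :
    IsCompact (cdisc p ρ) :=
  (isCompact_closedBall 0 ρ).image_of_continuousOn ((crd p).continuousOn_symm.mono h)

theorem isOpen_odisc {p : X} {ρ : ℝ} (h : closedBall 0 ρ ⊆ (crd p).target) :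
    IsOpen (odisc p ρ) :=
  (crd p).symm.isOpen_image_of_subset_source isOpen_ball (ball_subset_closedBall.trans h)

theorem odisc_subset_cdisc (p : X) (ρ : ℝ) : odisc p ρ ⊆ cdisc p ρ :=
  image_mono ball_subset_closedBall

theorem mem_odisc_self (p : X) {ρ : ℝ} (hρ : 0 < ρ) : p ∈ odisc p ρ :=
  ⟨0, mem_ball_self hρ, crd_symm_zero p⟩

theorem eventually_cdisc_subset {p : X} {N : Set X} (hN : N ∈ 𝓝 p) :
    ∀ᶠ ρ in 𝓝[>] (0 : ℝ), closedBall 0 ρ ⊆ (crd p).target ∧ cdisc p ρ ⊆ N := by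
  have hc : ContinuousAt (crd p).symm 0 := (crd p).continuousAt_symm (zero_mem_crd_target p)
  have h1 : (crd p).target ∩ (crd p).symm ⁻¹' N ∈ 𝓝 (0 : ℂ) :=
    inter_mem ((crd p).open_target.mem_nhds (zero_mem_crd_target p))
      (hc (by rwa [crd_symm_zero]))
  obtain ⟨ε, hε, h2⟩ := Metric.nhds_basis_closedBall.mem_iff.1 h1
  filter_upwards [Ioc_mem_nhdsGT hε] with ρ hρ
  have h3 := (closedBall_subset_closedBall hρ.2).trans h2
  exact ⟨fun z hz ↦ (h3 hz).1, image_subset_iff.2 fun z hz ↦ (h3 hz).2⟩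

theorem exists_cdisc_subset {p : X} {N : Set X} (hN : N ∈ 𝓝 p) :
    ∃ ρ > 0, closedBall 0 ρ ⊆ (crd p).target ∧ cdisc p ρ ⊆ N := by
  obtain ⟨ρ, h1, h2⟩ := ((eventually_cdisc_subset hN).and self_mem_nhdsWithin).exists
  exact ⟨ρ, h2, h1⟩

theorem harmAt_comp_crd [IsManifold 𝓘(ℂ) ω X] {p : X} {H : ℂ → ℝ} {ρ : ℝ}
    (h : closedBall 0 ρ ⊆ (crd p).target) (hH : HarmonicOnNhd H (ball 0 ρ)) {x : X}
    (hx : x ∈ odisc p ρ) : HarmAt (fun y ↦ H (crd p y)) x := by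
  obtain ⟨F, hF, hFH⟩ := hH.exists_analyticOnNhd_ball_re_eq
  refine ⟨fun y ↦ F (crd p y), ?_, ?_⟩
  · filter_upwards [(isOpen_odisc h).mem_nhds hx] with y hy
    rw [mem_odisc h] at hy
    exact DifferentiableAt.comp_mdifferentiableAt (hF _ (by simpa using hy.2)).differentiableAt
      (mdifferentiableAt_crd hy.1)
  · filter_upwards [(isOpen_odisc h).mem_nhds hx] with y hy
    rw [mem_odisc h] at hy
    exact (hFH (by simpa using hy.2)).symm

end Coordinates

/-! ### Perron families with prescribed singularities -/

section Perron

variable {X : Type*} [TopologicalSpace X] [ChartedSpace ℂ X]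

/-- The class of subharmonic functions on `U ⊆ K`, with singularities prescribed by the
local functions `a x`, that are bounded by `β` on `K \ U`. -/
def perronClass (K U : Set X) (β : X → ℝ) (a : X → X → ℝ) : Set (X → ℝ) :=
  {v | (∀ x ∈ U, ContinuousAt (fun y ↦ v y + a x y) x ∧ SubAt (fun y ↦ v y + a x y) x) ∧
    ∀ x ∈ K, x ∉ U → ContinuousWithinAt v K x ∧ v x ≤ β x}

/-- The singularities prescribed by `a` are locally compatible up to harmonic functions. -/
def IsGauge (U : Set X) (a : X → X → ℝ) : Prop :=
  ∀ x ∈ U, ∀ᶠ y in 𝓝 x, HarmAt (fun z ↦ a y z - a x z) y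

variable {K U : Set X} {β : X → ℝ} {a : X → X → ℝ}

theorem max_mem_perronClass {v w : X → ℝ} (hv : v ∈ perronClass K U β a)
    (hw : w ∈ perronClass K U β a) : (fun x ↦ max (v x) (w x)) ∈ perronClass K U β a := by
  refine ⟨fun x hx ↦ ?_, fun x hx hxU ↦ ?_⟩
  · simp only [← max_add_add_right]
    exact ⟨(hv.1 x hx).1.max (hw.1 x hx).1, (hv.1 x hx).2.max (hw.1 x hx).2⟩
  · exact ⟨(hv.2 x hx hxU).1.max (hw.2 x hx hxU).1, max_le (hv.2 x hx hxU).2 (hw.2 x hx hxU).2⟩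

/-- Supplies the properness condition `V ≠ univ` of the maximum principle `le_of_subAt`. -/
theorem odisc_ne_univ {p : X} {ρ : ℝ} (hρ : 0 < ρ) (h : closedBall 0 ρ ⊆ (crd p).target) :
    odisc p ρ ≠ univ := by
  intro hu
  have hmem : (ρ : ℂ) ∈ closedBall (0 : ℂ) ρ := by simp [abs_of_pos hρ]
  have : (crd p).symm ρ ∈ odisc p ρ := hu ▸ mem_univ _
  rw [mem_odisc h, (crd p).right_inv (h hmem)] at this
  simp [abs_of_pos hρ] at this

variable [IsManifold 𝓘(ℂ) ω X] [T2Space X] [PreconnectedSpace X]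

/-- Poisson modification of a continuous subharmonic function in a coordinate disc. -/
theorem exists_poisson_modification {p : X} {ρ : ℝ} (hρ : 0 < ρ)
    (h : closedBall 0 ρ ⊆ (crd p).target) {s : X → ℝ}
    (hs : ∀ y ∈ cdisc p ρ, ContinuousAt s y ∧ SubAt s y) :
    ∃ s' : X → ℝ, (∀ x, s x ≤ s' x) ∧ (∀ x ∉ cdisc p ρ, s' x = s x) ∧
      (∀ y ∈ cdisc p ρ, ContinuousAt s' y ∧ SubAt s' y) ∧
      HarmonicContOnCl (fun z ↦ s' ((crd p).symm z)) (ball 0 ρ) := by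
  classical
  have hcs : ContinuousOn (fun z ↦ s ((crd p).symm z)) (sphere 0 ρ) := by
    intro z hz
    have hz' := sphere_subset_closedBall hz
    exact ((hs _ ⟨z, hz', rfl⟩).1.comp
      ((crd p).continuousAt_symm (h hz'))).continuousWithinAt
  obtain ⟨H, hH, hHs⟩ := exists_harmonicContOnCl_eqOn_sphere hρ hcs
  have hcl : closure (ball (0 : ℂ) ρ) = closedBall 0 ρ := closure_ball _ hρ.ne'
  have hHc : ContinuousOn H (closedBall 0 ρ) := hcl ▸ hH.continuousOn
  have hHcrd : ContinuousOn (fun x ↦ H (crd p x)) (cdisc p ρ) := by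
    refine hHc.comp ((crd p).continuousOn.mono fun x hx ↦ ((mem_cdisc h).1 hx).1) fun x hx ↦ ?_
    simpa using ((mem_cdisc h).1 hx).2
  have hbd : ∀ x ∈ cdisc p ρ, x ∉ odisc p ρ → H (crd p x) = s x := by
    intro x hx hxo
    rw [mem_cdisc h] at hx
    rw [mem_odisc h, not_and, not_lt] at hxo
    rw [hHs _ (by simpa using le_antisymm hx.2 (hxo hx.1)), (crd p).left_inv hx.1]
  have hle : ∀ x ∈ cdisc p ρ, s x - H (crd p x) ≤ 0 := by
    refine le_of_subAt (isCompact_cdisc h) (isOpen_odisc h) (odisc_subset_cdisc p ρ)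
      (odisc_ne_univ hρ h) (ContinuousOn.sub (fun x hx ↦ (hs x hx).1.continuousWithinAt) hHcrd)
      (fun x hx ↦ ?_) fun x hx hxo ↦ by rw [hbd x hx hxo, sub_self]
    simpa only [sub_eq_add_neg] using (hs x (odisc_subset_cdisc p ρ hx)).2.add_harm
      (harmAt_comp_crd h hH.harmonicOnNhd hx).neg
  set s' : X → ℝ := fun x ↦ if x ∈ cdisc p ρ then H (crd p x) else s x with hs'
  have hss' : ∀ x, s x ≤ s' x := fun x ↦ by
    by_cases hx : x ∈ cdisc p ρ
    · simpa [hs', hx] using hle x hx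
    · simp [hs', hx]
  refine ⟨s', hss', fun x hx ↦ by simp [hs', hx], fun y hy ↦ ?_, ?_⟩
  · by_cases hyo : y ∈ odisc p ρ
    · have : HarmAt s' y := (harmAt_comp_crd h hH.harmonicOnNhd hyo).congr (by
        filter_upwards [(isOpen_odisc h).mem_nhds hyo] with z hz
        simp [hs', odisc_subset_cdisc p ρ hz])
      exact ⟨this.continuousAt, this.subAt⟩
    · have hy' : s' y = s y := by simp only [hs', if_pos hy]; exact hbd y hy hyo
      -- On the bounding circle the modification touches `s` from above, so subharmonicity is
      -- inherited.
      refine ⟨?_, (hs y hy).2.of_le hy' (.of_forall hss')⟩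
      rw [← continuousWithinAt_univ, ← union_compl_self (cdisc p ρ)]
      refine ContinuousWithinAt.union ?_ ?_
      · exact (hHcrd y hy).congr (fun z hz ↦ by simp [hs', hz]) (by simp [hs', hy])
      · exact (hs y hy).1.continuousWithinAt.congr (fun z hz ↦ if_neg hz) hy'
  · have heq : ∀ z ∈ closedBall (0 : ℂ) ρ, s' ((crd p).symm z) = H z := fun z hz ↦ by
      have : (crd p).symm z ∈ cdisc p ρ := ⟨z, hz, rfl⟩
      simp [hs', this, (crd p).right_inv (h hz)]
    refine ⟨fun z hz ↦ (harmonicAt_congr_nhds ?_).1 (hH.harmonicOnNhd z hz),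
      hH.continuousOn.congr fun z hz ↦ heq z (hcl ▸ hz)⟩
    filter_upwards [isOpen_ball.mem_nhds hz] with w hw
    exact (heq w (ball_subset_closedBall hw)).symm

/-- By compatibility of the gauge, `v + a p` is an honest subharmonic function on the whole disc; it
is modified there and `a p` is subtracted again. -/
theorem exists_modification_mem_perronClass {p : X} {ρ : ℝ} (hρ : 0 < ρ)
    (h : closedBall 0 ρ ⊆ (crd p).target) (hU : cdisc p ρ ⊆ U)
    (hg : ∀ y ∈ cdisc p ρ, HarmAt (fun z ↦ a y z - a p z) y)
    {v : X → ℝ} (hv : v ∈ perronClass K U β a) :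
    ∃ w ∈ perronClass K U β a, (∀ x, v x ≤ w x) ∧
      HarmonicContOnCl (fun z ↦ w ((crd p).symm z) + a p ((crd p).symm z)) (ball 0 ρ) := by
  obtain ⟨s', h1, h2, h3, h4⟩ := exists_poisson_modification hρ h (s := fun x ↦ v x + a p x)
    (fun y hy ↦ by
      have hA := hv.1 y (hU hy)
      have hB := hg y hy
      have := (hA.1.sub hB.continuousAt)
      have h' := hA.2.add_harm hB.neg
      constructor
      · refine this.congr (.of_forall fun z ↦ ?_)
        simp only [Pi.sub_apply]; ring
      · refine h'.congr (.of_forall fun z ↦ ?_)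
        ring)
  refine ⟨fun x ↦ s' x - a p x, ⟨fun x hx ↦ ?_, fun x hx hxU ↦ ?_⟩, fun x ↦ by
    linarith [h1 x], by simpa using h4⟩
  · by_cases hxd : x ∈ cdisc p ρ
    · have hB := hg x hxd
      have hA := h3 x hxd
      constructor
      · refine (hA.1.add hB.continuousAt).congr (.of_forall fun z ↦ ?_)
        simp; ring
      · refine (hA.2.add_harm hB).congr (.of_forall fun z ↦ ?_)
        ring
    · have : ∀ᶠ y in 𝓝 x, s' y - a p y + a x y = v y + a x y := by
        filter_upwards [(isCompact_cdisc h).isClosed.isOpen_compl.mem_nhds hxd] with y hy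
        rw [h2 y hy]; ring
      exact ⟨(hv.1 x hx).1.congr (by filter_upwards [this] with y hy using hy.symm),
        (hv.1 x hx).2.congr this⟩
  · have hxd : x ∉ cdisc p ρ := fun h' ↦ hxU (hU h')
    have : ∀ᶠ y in 𝓝 x, s' y - a p y = v y := by
      filter_upwards [(isCompact_cdisc h).isClosed.isOpen_compl.mem_nhds hxd] with y hy
      rw [h2 y hy]; ring
    refine ⟨(hv.2 x hx hxU).1.congr_of_eventuallyEq (this.filter_mono nhdsWithin_le_nhds)
      this.self_of_nhds, ?_⟩
    exact this.self_of_nhds.trans_le (hv.2 x hx hxU).2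

/-- **Perron's theorem**: the upper envelope of a Perron class is harmonic. -/
theorem harmAt_iSup_perronClass (hUo : IsOpen U) (ha : IsGauge U a)
    (hne : (perronClass K U β a).Nonempty)
    (hb : ∀ x ∈ U, BddAbove (range fun v : perronClass K U β a ↦ v.1 x)) {p : X} (hp : p ∈ U) :
    HarmAt (fun x ↦ (⨆ v : perronClass K U β a, v.1 x) + a p x) p := by
  have : Nonempty (perronClass K U β a) := hne.to_subtype
  obtain ⟨ρ, hρ, h, hN⟩ := exists_cdisc_subset (inter_mem (hUo.mem_nhds hp) (ha p hp))
  have hU : cdisc p ρ ⊆ U := fun x hx ↦ (hN hx).1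
  have hmem : ∀ z ∈ closedBall (0 : ℂ) ρ, (crd p).symm z ∈ U := fun z hz ↦ hU ⟨z, hz, rfl⟩
  -- Maxima make the family directed and Poisson modifications provide the harmonic majorants; the
  -- single gauge `a p` serves on the whole disc.
  have key := harmonicOnNhd_iSup_of_directed (R := ρ) (f := fun (v : perronClass K U β a) z ↦
    v.1 ((crd p).symm z) + a p ((crd p).symm z))
    (fun v w ↦ ⟨⟨_, max_mem_perronClass v.2 w.2⟩, fun z _ ↦
      ⟨add_le_add_left (le_max_left _ _) _, add_le_add_left (le_max_right _ _) _⟩⟩)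
    (fun v ↦ by
      obtain ⟨w, hw, h1, h2⟩ := exists_modification_mem_perronClass hρ h hU
        (fun y hy ↦ (hN hy).2) v.2
      exact ⟨⟨w, hw⟩, h2, fun z _ ↦ add_le_add_left (h1 _) _⟩)
    (fun z hz ↦ by
      obtain ⟨M, hM⟩ := hb _ (hmem z (ball_subset_closedBall hz))
      refine ⟨M + a p ((crd p).symm z), ?_⟩
      rintro _ ⟨v, rfl⟩
      exact add_le_add_left (hM ⟨v, rfl⟩) _)
  refine (harmAt_comp_crd h key (mem_odisc_self p hρ)).congr ?_
  filter_upwards [(isOpen_odisc h).mem_nhds (mem_odisc_self p hρ)] with x hx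
  have hxs := ((mem_odisc h).1 hx).1
  rw [(crd p).left_inv hxs, ciSup_add (hb x (hU (odisc_subset_cdisc p ρ hx)))]

end Perron

/-! ### Barriers at the smooth boundary -/

section Barrier

variable {X : Type*} [TopologicalSpace X] [ChartedSpace ℂ X]

theorem differentiableAt_of_mem_contDiffGroupoid {e : OpenPartialHomeomorph ℂ ℂ}
    (he : e ∈ contDiffGroupoid ∞ 𝓘(ℝ, ℂ)) {z : ℂ} (hz : z ∈ e.source) :
    DifferentiableAt ℝ e z := by
  have h := contMDiffOn_of_mem_contDiffGroupoid he
  rw [contMDiffOn_iff_contDiffOn] at h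
  exact (h.contDiffAt (e.open_source.mem_nhds hz)).differentiableAt (by simp)

omit [ChartedSpace ℂ X] in
theorem im_eq_zero_of_notMem_interior {K : Set X} {e : OpenPartialHomeomorph X ℂ}
    (heK : ∀ x ∈ e.source, x ∈ K ↔ 0 ≤ (e x).im) {x : X} (hx : x ∈ e.source)
    (hK : x ∈ K) (hxi : x ∉ interior K) : (e x).im = 0 := by
  refine le_antisymm ?_ ((heK x hx).1 hK)
  by_contra! hpos
  refine hxi (mem_interior_iff_mem_nhds.2 ?_)
  filter_upwards [e.open_source.mem_nhds hx, (e.continuousAt hx).eventually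
    ((isOpen_lt continuous_const Complex.continuous_im).mem_nhds hpos)] with y h1 h2
  exact (heK y h1).2 (le_of_lt h2)

omit [ChartedSpace ℂ X] in
theorem exists_mem_interior_of_chart {K N : Set X} {e : OpenPartialHomeomorph X ℂ}
    (heK : ∀ x ∈ e.source, x ∈ K ↔ 0 ≤ (e x).im) {x : X} (hx : x ∈ e.source) (hxK : x ∈ K)
    (hN : N ∈ 𝓝 x) : ∃ y ∈ N, y ∈ interior K := by
  have hc : ContinuousAt (fun t : ℝ ↦ e.symm (e x + t * Complex.I)) 0 := by
    refine ContinuousAt.comp (f := fun t : ℝ ↦ e x + t * Complex.I) ?_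
      (by fun_prop)
    simpa using e.continuousAt_symm (e.map_source hx)
  have h1 : ∀ᶠ t : ℝ in 𝓝[>] 0, e.symm (e x + t * Complex.I) ∈ N :=
    (hc.eventually (by simpa [hx] using hN)).filter_mono nhdsWithin_le_nhds
  have h2 : ∀ᶠ t : ℝ in 𝓝[>] 0, e x + t * Complex.I ∈ e.target := by
    have hc' : ContinuousAt (fun t : ℝ ↦ e x + t * Complex.I) 0 := by fun_prop
    exact (hc'.eventually (e.open_target.mem_nhds (by simpa using e.map_source hx))).filter_mono
      nhdsWithin_le_nhds
  obtain ⟨t, ⟨h3, h4⟩, h5⟩ := ((h1.and h2).and self_mem_nhdsWithin).exists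
  refine ⟨_, h3, ?_⟩
  by_contra hni
  have hs := e.map_target h4
  have ht : (0 : ℝ) < t := h5
  have him : 0 < (e (e.symm (e x + t * Complex.I))).im := by
    rw [e.right_inv h4]
    have := (heK x hx).1 hxK
    simp only [Complex.add_im, Complex.mul_im, Complex.ofReal_re, Complex.I_im, Complex.ofReal_im,
      Complex.I_re]
    linarith
  exact him.ne' (im_eq_zero_of_notMem_interior heK hs ((heK _ hs).2 him.le) hni)

theorem IsSubsurfaceWithSmoothBoundary.subset_closure_interior {K : Set X}
    (hK : IsSubsurfaceWithSmoothBoundary K) : K ⊆ closure (interior K) := by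
  intro x hx
  obtain ⟨e, _, hxe, heK⟩ := hK x hx
  rw [mem_closure_iff_nhds]
  intro N hN
  obtain ⟨y, h1, h2⟩ := exists_mem_interior_of_chart heK hxe hx hN
  exact ⟨y, h1, h2⟩

/-- At a boundary point of a sub-surface there is a short segment leaving the sub-surface. -/
theorem IsSubsurfaceWithSmoothBoundary.exists_exterior_segment {K : Set X}
    (hK : IsSubsurfaceWithSmoothBoundary K) {ζ : X} (hζ : ζ ∈ K) (hζi : ζ ∉ interior K) :
    ∃ n : ℂ, n ≠ 0 ∧ ∃ δ > 0, ∀ t : ℝ, 0 < t → t < δ → ∀ x ∈ (crd ζ).source,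
      crd ζ x = -t * n → x ∉ K := by
  obtain ⟨e, he, hζe, heK⟩ := hK ζ hζ
  set φ := chartAt ℂ ζ with hφ
  have hζφ : ζ ∈ φ.source := mem_chart_source ℂ ζ
  obtain ⟨h1, h2⟩ := mem_maximalAtlas_iff.1 he φ (chart_mem_atlas ℂ ζ)
  have hS : DifferentiableAt ℝ (e.symm ≫ₕ φ) (e ζ) :=
    differentiableAt_of_mem_contDiffGroupoid h1 (by simp [hζe, hζφ])
  have hT : DifferentiableAt ℝ (φ.symm ≫ₕ e) (φ ζ) :=
    differentiableAt_of_mem_contDiffGroupoid h2 (by simp [hζe, hζφ])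
  have hSζ : (e.symm ≫ₕ φ) (e ζ) = φ ζ := by simp [hζe]
  have hTζ : (φ.symm ≫ₕ e) (φ ζ) = e ζ := by simp [hζφ]
  set S := (e.symm ≫ₕ φ : ℂ → ℂ) with hSdef
  set T := (φ.symm ≫ₕ e : ℂ → ℂ) with hTdef
  have hTS : ∀ᶠ z in 𝓝 (e ζ), T (S z) = z := by
    have hc : ContinuousAt e.symm (e ζ) := e.continuousAt_symm (e.map_source hζe)
    filter_upwards [e.open_target.mem_nhds (e.map_source hζe),
      hc.eventually (φ.open_source.mem_nhds (by simpa [hζe] using hζφ))] with z hz1 hz2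
    have hz2' : e.symm z ∈ φ.source := hz2
    simp only [hTdef, hSdef, OpenPartialHomeomorph.coe_trans, Function.comp, φ.left_inv hz2',
      e.right_inv hz1]
  have hcomp : HasFDerivAt (fun z ↦ T (S z)) ((fderiv ℝ T (φ ζ)).comp (fderiv ℝ S (e ζ))) (e ζ) :=
    HasFDerivAt.comp (e ζ) (by rw [hSζ]; exact hT.hasFDerivAt) hS.hasFDerivAt
  have hid : (fderiv ℝ T (φ ζ)).comp (fderiv ℝ S (e ζ)) = ContinuousLinearMap.id ℝ ℂ :=
    (hcomp.congr_of_eventuallyEq (by filter_upwards [hTS] with z hz using hz.symm)).unique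
      (hasFDerivAt_id (e ζ))
  -- `n` is the inward direction of the boundary chart, read in the holomorphic chart. Moving along
  -- `-n` makes the imaginary part in `e` decrease at unit rate, hence leave `K`.
  set n := fderiv ℝ S (e ζ) Complex.I with hn
  have hTn : fderiv ℝ T (φ ζ) n = Complex.I := by
    have := congrArg (fun L ↦ L Complex.I) hid
    simpa using this
  refine ⟨n, fun h0 ↦ Complex.I_ne_zero (by rw [← hTn, h0, map_zero]), ?_⟩
  have hline : HasDerivAt (fun t : ℝ ↦ φ ζ + (-t) * n) (-n) 0 := by
    have h3 : HasDerivAt (fun t : ℝ ↦ (t : ℂ)) 1 0 := Complex.ofRealCLM.hasDerivAt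
    simpa using (h3.neg.mul_const n).const_add (φ ζ)
  have h4 : HasDerivAt (fun t : ℝ ↦ T (φ ζ + (-t) * n)) (fderiv ℝ T (φ ζ) (-n)) 0 :=
    HasFDerivAt.comp_hasDerivAt (0 : ℝ) 
      (by rw [show φ ζ + -((0 : ℝ) : ℂ) * n = φ ζ by simp]; exact hT.hasFDerivAt) hline
  have h5 : HasDerivAt (fun t : ℝ ↦ (T (φ ζ + (-t) * n)).im) (-1) 0 := by
    have := Complex.imCLM.hasFDerivAt.comp_hasDerivAt (0 : ℝ) h4
    simpa [hTn, Function.comp_def] using this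
  have h6 : ∀ᶠ t : ℝ in 𝓝[>] 0, (T (φ ζ + (-t) * n)).im < 0 := by
    have h7 := h5.tendsto_slope.mono_left (nhdsGT_le_nhdsNE (0 : ℝ))
    filter_upwards [h7.eventually (gt_mem_nhds (show (-1 : ℝ) < 0 by norm_num)),
      self_mem_nhdsWithin] with t ht ht0
    have hz : (T (φ ζ + (-((0 : ℝ) : ℂ)) * n)).im = 0 := by
      simpa [hTζ] using im_eq_zero_of_notMem_interior heK hζe hζ hζi
    simp only [slope, vsub_eq_sub, hz, sub_zero, smul_eq_mul] at ht
    have ht0' : (0 : ℝ) < t := ht0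
    by_contra! hcon
    exact absurd ht (not_lt.2 (mul_nonneg (inv_nonneg.2 ht0'.le) hcon))
  have h8 : ∀ᶠ t : ℝ in 𝓝[>] 0, φ.symm (φ ζ + (-t) * n) ∈ e.source := by
    have hc : ContinuousAt (fun t : ℝ ↦ φ.symm (φ ζ + (-t) * n)) 0 := by
      refine ContinuousAt.comp (f := fun t : ℝ ↦ φ ζ + (-t) * n) ?_ hline.continuousAt
      simpa using φ.continuousAt_symm (φ.map_source hζφ)
    exact (hc.eventually (e.open_source.mem_nhds (by simpa [hζφ] using hζe))).filter_mono
      nhdsWithin_le_nhds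
  obtain ⟨δ, hδ, h9⟩ := mem_nhdsGT_iff_exists_Ioo_subset.1 (h6.and h8)
  refine ⟨δ, hδ, fun t ht0 htδ x hx hxt hxK ↦ ?_⟩
  obtain ⟨h10, h11⟩ := h9 ⟨ht0, htδ⟩
  have hxφ : x ∈ φ.source := by simpa [crd] using hx
  have hxc : φ x = φ ζ + (-t) * n := by
    have : φ x - φ ζ = -t * n := by simpa [crd, sub_eq_add_neg] using hxt
    rw [← this]; ring
  rw [← hxc, φ.left_inv hxφ] at h11
  rw [← hxc] at h10
  simp only [hTdef, OpenPartialHomeomorph.coe_trans, Function.comp, φ.left_inv hxφ] at h10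
  exact absurd ((heK x h11).1 hxK) (not_le.2 h10)

/-- Halving an argument in `(-π, π)` puts it in `(-π / 2, π / 2)`. -/
theorem re_sqrt_pos {w : ℂ} (hw : w ∈ Complex.slitPlane) : 0 < (w ^ (1 / 2 : ℂ)).re := by
  have h0 : w ≠ 0 := Complex.slitPlane_ne_zero hw
  rw [Complex.cpow_def_of_ne_zero h0, Complex.exp_re]
  refine mul_pos (Real.exp_pos _) (Real.cos_pos_of_mem_Ioo ?_)
  have h1 := Complex.neg_pi_lt_arg w
  have h2 := lt_of_le_of_ne (Complex.arg_le_pi w) (Complex.mem_slitPlane_iff_arg.1 hw).1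
  have : (Complex.log w * (1 / 2)).im = w.arg / 2 := by
    rw [show (1 / 2 : ℂ) = ((1 / 2 : ℝ) : ℂ) by norm_num, Complex.im_mul_ofReal, Complex.log_im]
    ring
  rw [this]
  constructor <;> linarith

variable [IsManifold 𝓘(ℂ) ω X]

/-- Existence of barriers at the boundary points of a sub-surface. -/
theorem IsSubsurfaceWithSmoothBoundary.exists_barrier {K : Set X}
    (hK : IsSubsurfaceWithSmoothBoundary K) {ζ : X} (hζ : ζ ∈ K) (hζi : ζ ∉ interior K)
    {N : Set X} (hN : N ∈ 𝓝 ζ) :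
    ∃ ρ > 0, closedBall 0 ρ ⊆ (crd ζ).target ∧ cdisc ζ ρ ⊆ N ∧ ∃ b : X → ℝ, b ζ = 0 ∧
      ∀ x ∈ K ∩ cdisc ζ ρ, ContinuousAt b x ∧ 0 ≤ b x ∧ (x ≠ ζ → HarmAt b x ∧ 0 < b x) := by
  obtain ⟨n, hn, δ, hδ, hray⟩ := hK.exists_exterior_segment hζ hζi
  have hδn : 0 < δ * ‖n‖ := mul_pos hδ (norm_pos_iff.2 hn)
  -- With `ρ < δ * ‖n‖`, the part of the ray through `-n` inside the disc lies on the exterior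
  -- segment. So `crd ζ x / n` avoids the slit of the square root for `x ∈ K` other than `ζ`.
  obtain ⟨ρ, ⟨⟨hρt, hρN⟩, hρδ⟩⟩ := ((eventually_cdisc_subset hN).and (Ioo_mem_nhdsGT hδn)).exists
  refine ⟨ρ, hρδ.1, hρt, hρN, fun x ↦ ((crd ζ x / n) ^ (1 / 2 : ℂ)).re, by simp [crd_self], ?_⟩
  rintro x ⟨hxK, hxd⟩
  rw [mem_cdisc hρt] at hxd
  have hw : x ≠ ζ → crd ζ x / n ∈ Complex.slitPlane := by
    intro hne
    by_contra hw
    rw [Complex.mem_slitPlane_iff_not_le_zero, not_not] at hw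
    obtain ⟨hre, him⟩ := Complex.le_def.1 hw
    simp only [Complex.zero_re, Complex.zero_im] at hre him
    have hwr : crd ζ x / n = ((crd ζ x / n).re : ℂ) :=
      Complex.ext (by simp) (by simpa using him)
    have hc : crd ζ x = -(↑(-(crd ζ x / n).re) : ℂ) * n := by
      rw [Complex.ofReal_neg, neg_neg, ← hwr, div_mul_cancel₀ _ hn]
    have hne0 : (crd ζ x / n).re ≠ 0 := by
      intro h0
      rw [h0] at hc
      simp only [neg_zero, Complex.ofReal_zero, zero_mul] at hc
      exact hne ((crd_eq_zero_iff hxd.1).1 hc)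
    refine hray (-(crd ζ x / n).re) (by
      have := lt_of_le_of_ne hre hne0
      linarith) ?_ x hxd.1 hc hxK
    have h1 : ‖crd ζ x / n‖ < δ := by
      rw [norm_div, div_lt_iff₀ (norm_pos_iff.2 hn)]
      exact hxd.2.trans_lt hρδ.2
    have h2 := Complex.abs_re_le_norm (crd ζ x / n)
    have h3 := neg_abs_le (crd ζ x / n).re
    linarith
  have hcr : ContinuousAt (fun y ↦ crd ζ y / n) x :=
    ((crd ζ).continuousAt hxd.1).div_const n
  refine ⟨?_, ?_, fun hne ↦ ⟨?_, re_sqrt_pos (hw hne)⟩⟩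
  · refine Complex.continuous_re.continuousAt.comp
      (ContinuousAt.comp (g := fun w : ℂ ↦ w ^ (1 / 2 : ℂ)) ?_ hcr)
    refine Complex.continuousAt_cpow_const_of_re_pos ?_ (by norm_num)
    by_cases hne : x = ζ
    · left; simp [hne, crd_self]
    · rcases hw hne with h | h
      · exact Or.inl h.le
      · exact Or.inr h
  · by_cases hne : x = ζ
    · simp [hne, crd_self]
    · exact (re_sqrt_pos (hw hne)).le
  · refine ⟨fun y ↦ (crd ζ y / n) ^ (1 / 2 : ℂ), ?_, .of_forall fun _ ↦ rfl⟩
    filter_upwards [(crd ζ).open_source.mem_nhds hxd.1,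
      hcr.eventually (Complex.isOpen_slitPlane.mem_nhds (hw hne))] with y h1 h2
    refine DifferentiableAt.comp_mdifferentiableAt (g := fun w : ℂ ↦ (w / n) ^ (1 / 2 : ℂ)) ?_
      (mdifferentiableAt_crd h1)
    exact (differentiableAt_id.div_const n).cpow_const h2

/-- Uniform boundary estimate for subharmonic functions that are nonpositive on the boundary. -/
theorem IsSubsurfaceWithSmoothBoundary.exists_nhds_forall_le [T2Space X] [PreconnectedSpace X]
    {K : Set X} (hK : IsSubsurfaceWithSmoothBoundary K) (hKc : IsCompact K) {ζ : X} (hζ : ζ ∈ K)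
    (hζi : ζ ∉ interior K) {N : Set X} (hN : N ∈ 𝓝 ζ) (M : ℝ) {ε : ℝ} (hε : 0 < ε) :
    ∃ N' ∈ 𝓝 ζ, ∀ v : X → ℝ, ContinuousOn v (K ∩ N) → (∀ x ∈ interior K ∩ N, SubAt v x) →
      (∀ x ∈ K ∩ N, v x ≤ M) → (∀ x ∈ K ∩ N, x ∉ interior K → v x ≤ 0) →
      ∀ x ∈ K ∩ N', v x ≤ ε := by
  obtain ⟨ρ, hρ, hρt, hρN, b, hbζ, hb⟩ := hK.exists_barrier hζ hζi hN
  have hbc : ContinuousOn b (K ∩ cdisc ζ ρ) := fun x hx ↦ (hb x hx).1.continuousWithinAt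
  have hLc : IsCompact (K ∩ cdisc ζ ρ) := hKc.inter (isCompact_cdisc hρt)
  have hCc : IsCompact ((K ∩ cdisc ζ ρ) \ odisc ζ ρ) := hLc.diff (isOpen_odisc hρt)
  obtain ⟨m, hm, hbm⟩ : ∃ m > 0, ∀ x ∈ (K ∩ cdisc ζ ρ) \ odisc ζ ρ, m ≤ b x := by
    rcases ((K ∩ cdisc ζ ρ) \ odisc ζ ρ).eq_empty_or_nonempty with h | h
    · exact ⟨1, one_pos, by simp [h]⟩
    · obtain ⟨x, hx, hmin⟩ := hCc.exists_isMinOn h (hbc.mono sdiff_subset)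
      refine ⟨b x, ((hb x hx.1).2.2 ?_).2, fun y hy ↦ hmin hy⟩
      rintro rfl
      exact hx.2 (mem_odisc_self _ hρ)
  -- This multiple of the barrier exceeds `M` on the part of the circle inside `K`. It depends on
  -- the bound `M` but not on `v`, so the estimate survives the passage to an upper envelope.
  set A := max M 0 / m with hA
  have hA0 : 0 ≤ A := div_nonneg (le_max_right _ _) hm.le
  have hAm : M ≤ A * m := by
    rw [hA, div_mul_cancel₀ _ hm.ne']; exact le_max_left _ _
  have hbζc : ContinuousAt (fun x ↦ A * b x) ζ :=
    (hb ζ ⟨hζ, odisc_subset_cdisc _ _ (mem_odisc_self ζ hρ)⟩).1.const_mul A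
  refine ⟨_, inter_mem ((isOpen_odisc hρt).mem_nhds (mem_odisc_self ζ hρ))
    (hbζc.eventually (gt_mem_nhds (by simpa [hbζ] using hε))), fun v hvc hvs hvM hv0 x hx ↦ ?_⟩
  have key : ∀ x ∈ K ∩ cdisc ζ ρ, v x - A * b x ≤ 0 := by
    refine le_of_subAt (V := interior K ∩ odisc ζ ρ) hLc (isOpen_interior.inter (isOpen_odisc hρt))
      (inter_subset_inter interior_subset (odisc_subset_cdisc _ _))
      (fun h ↦ odisc_ne_univ hρ hρt (univ_subset_iff.1 (h ▸ inter_subset_right)))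
      ((hvc.mono (inter_subset_inter_right _ hρN)).sub (hbc.const_mul A)) ?_ ?_
    · rintro y ⟨hyi, hyo⟩
      have hyK : y ∈ K ∩ cdisc ζ ρ := ⟨interior_subset hyi, odisc_subset_cdisc _ _ hyo⟩
      obtain ⟨F, hF, hbF⟩ := ((hb y hyK).2.2 (by rintro rfl; exact hζi hyi)).1
      have hAb : HarmAt (fun z ↦ A * b z) y := by
        refine ⟨fun z ↦ A * F z, ?_, ?_⟩
        · filter_upwards [hF] with z hz
          exact DifferentiableAt.comp_mdifferentiableAt (g := fun w ↦ (A : ℂ) * w) (by fun_prop) hz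
        · filter_upwards [hbF] with z hz
          simp [hz]
      simpa only [sub_eq_add_neg] using (hvs y ⟨hyi, hρN hyK.2⟩).add_harm hAb.neg
    · rintro y hy hyV
      by_cases hyi : y ∈ interior K
      · have hyo : y ∉ odisc ζ ρ := fun h ↦ hyV ⟨hyi, h⟩
        have := hbm y ⟨hy, hyo⟩
        have h2 := hvM y ⟨hy.1, hρN hy.2⟩
        nlinarith
      · have h1 := hv0 y ⟨hy.1, hρN hy.2⟩ hyi
        have h2 := mul_nonneg hA0 (hb y hy).2.1
        linarith
  have h1 := key x ⟨hx.1, odisc_subset_cdisc _ _ hx.2.1⟩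
  have h2 : A * b x < ε := hx.2.2
  linarith

end Barrier

/-! ### The logarithmic gauge and a strict bound away from a disc -/

section Green

variable {X : Type*} [TopologicalSpace X] [ChartedSpace ℂ X]

theorem HarmAt.const_mul {u : X → ℝ} {x : X} (hu : HarmAt u x) (c : ℝ) :
    HarmAt (fun y ↦ c * u y) x := by
  obtain ⟨F, hF, huF⟩ := hu
  refine ⟨fun z ↦ c * F z, ?_, ?_⟩
  · filter_upwards [hF] with z hz
    exact DifferentiableAt.comp_mdifferentiableAt (g := fun w ↦ (c : ℂ) * w) (by fun_prop) hz
  · filter_upwards [huF] with z hz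
    simp [hz]

theorem SubAt.const_mul {v : X → ℝ} {x : X} (hv : SubAt v x) {c : ℝ} (hc : 0 < c) :
    SubAt (fun y ↦ c * v y) x := by
  intro h hh hmax
  have h1 : ∀ y, c * v y - h y = c * (v y - c⁻¹ * h y) := fun y ↦ by field_simp
  simp only [h1] at hmax ⊢
  filter_upwards [hv _ (hh.const_mul c⁻¹) (by
    filter_upwards [hmax] with y hy
    exact le_of_mul_le_mul_left hy hc)] with y hy
  rw [hy]

open Classical in
/-- The logarithmic singularity at `p`. The junk value `Real.log 0 = 0` makes the value at `p` of
a function with this singularity equal to its regularised value. -/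
noncomputable def poleGauge (p x y : X) : ℝ := if x = p then Real.log ‖crd p y‖ else 0

theorem poleGauge_self (p : X) : poleGauge p p = fun y ↦ Real.log ‖crd p y‖ := by
  ext y; simp [poleGauge]

theorem poleGauge_of_ne {p x : X} (h : x ≠ p) : poleGauge p x = fun _ ↦ 0 := by
  ext y; simp [poleGauge, h]

/-- Coordinate annuli are connected. -/
theorem isPreconnected_annulus {p : X} {r R : ℝ} (hr : 0 < r)
    (h : closedBall 0 R ⊆ (crd p).target) : IsPreconnected (odisc p R \ cdisc p r) := by
  rcases le_or_gt R r with hrR | hrR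
  · convert isPreconnected_empty using 1
    refine sdiff_eq_empty.2 ((odisc_subset_cdisc p R).trans ?_)
    exact image_mono (closedBall_subset_closedBall hrR)
  have hR : 0 < R := hr.trans hrR
  have h' : closedBall 0 r ⊆ (crd p).target := (closedBall_subset_closedBall hrR.le).trans h
  have hset : odisc p R \ cdisc p r =
      (fun w ↦ (crd p).symm (Complex.exp w)) '' {w | Real.log r < w.re ∧ w.re < Real.log R} := by
    ext x
    constructor
    · rintro ⟨h1, h2⟩
      rw [mem_odisc h] at h1
      rw [mem_cdisc h', not_and, not_le] at h2
      have h3 := h2 h1.1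
      have h4 : crd p x ≠ 0 := norm_pos_iff.1 (hr.trans h3)
      refine ⟨Complex.log (crd p x), ?_, ?_⟩
      · simp only [mem_ofPred_eq, Complex.log_re]
        exact ⟨Real.log_lt_log hr h3, Real.log_lt_log (hr.trans h3) h1.2⟩
      · simp only [Complex.exp_log h4, (crd p).left_inv h1.1]
    · rintro ⟨w, ⟨h1, h2⟩, rfl⟩
      have h3 : ‖Complex.exp w‖ < R := by
        rw [Complex.norm_exp, ← Real.exp_log hR]; exact Real.exp_lt_exp.2 h2
      have h4 : r < ‖Complex.exp w‖ := by
        rw [Complex.norm_exp]; nth_rw 1 [← Real.exp_log hr]; exact Real.exp_lt_exp.2 h1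
      have h5 : Complex.exp w ∈ (crd p).target := h (by simpa using h3.le)
      constructor
      · exact ⟨_, by simpa using h3, rfl⟩
      · rw [mem_cdisc h', not_and, not_le, (crd p).right_inv h5]
        exact fun _ ↦ h4
  rw [hset]
  refine IsPreconnected.image ?_ _ ?_
  · refine Convex.isPreconnected ?_
    exact ((convex_halfSpace_gt (f := Complex.re) (Complex.reCLM.isLinear) (Real.log r)).inter
      (convex_halfSpace_lt (f := Complex.re) (Complex.reCLM.isLinear) (Real.log R)))
  · refine (crd p).continuousOn_symm.comp Complex.continuous_exp.continuousOn ?_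
    rintro w ⟨h1, h2⟩
    refine h ?_
    rw [mem_closedBall_zero_iff, Complex.norm_exp, ← Real.exp_log hR]
    exact Real.exp_le_exp.2 h2.le

theorem isGauge_zero (U : Set X) : IsGauge U (fun _ _ ↦ (0 : ℝ)) :=
  fun _ _ ↦ .of_forall fun y ↦ by simpa using harmAt_const 0 y

variable [IsManifold 𝓘(ℂ) ω X]

/-- The set where the bound is attained is open by the strong maximum principle and relatively
closed by continuity. -/
theorem HarmAt.eqOn_of_isPreconnected {u : X → ℝ} {V : Set X} {m : ℝ} (hV : IsOpen V)
    (hVc : IsPreconnected V) (hu : ∀ x ∈ V, HarmAt u x) (hm : ∀ x ∈ V, u x ≤ m)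
    {x₀ : X} (hx₀ : x₀ ∈ V) (hux₀ : u x₀ = m) : ∀ x ∈ V, u x = m := by
  have hsub : V ⊆ {x ∈ V | u x = m} := by
    refine hVc.subset_of_closure_inter_subset ?_ ⟨x₀, hx₀, hx₀, hux₀⟩ ?_
    · refine isOpen_iff_mem_nhds.2 fun x hx ↦ ?_
      have hmax : IsLocalMax u x := by
        filter_upwards [hV.mem_nhds hx.1] with y hy
        rw [hx.2]; exact hm y hy
      filter_upwards [(hu x hx.1).eventually_eq_of_isLocalMax hmax, hV.mem_nhds hx.1]
        with y h1 h2 using ⟨h2, h1.trans hx.2⟩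
    · rintro x ⟨hxc, hxV⟩
      refine ⟨hxV, ?_⟩
      have hmem : u x ∈ closure {m} :=
        ((hu x hxV).continuousAt.continuousWithinAt.mono (fun y hy ↦ hy)).mem_closure hxc
          (fun y hy ↦ hy.2)
      simpa using hmem
  exact fun x hx ↦ (hsub hx).2

theorem eventually_mdifferentiableAt_crd {p x : X} (hx : x ∈ (crd p).source) :
    ∀ᶠ y in 𝓝 x, MDifferentiableAt 𝓘(ℂ) 𝓘(ℂ) (crd p) y := by
  filter_upwards [(crd p).open_source.mem_nhds hx] with y hy using mdifferentiableAt_crd hy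

theorem harmAt_log_norm_crd {p x : X} (hx : x ∈ (crd p).source) (hxp : x ≠ p) :
    HarmAt (fun y ↦ Real.log ‖crd p y‖) x :=
  harmAt_log_norm (eventually_mdifferentiableAt_crd hx) fun h ↦ hxp ((crd_eq_zero_iff hx).1 h)

/-- The gauges at `p` and at a nearby point differ by `log ‖crd p ·‖`, which is harmonic off `p`. -/
theorem isGauge_poleGauge [T2Space X] (U : Set X) (p : X) : IsGauge U (poleGauge p) := by
  intro x _
  by_cases hx : x = p
  · subst hx
    filter_upwards [(crd x).open_source.mem_nhds (mem_crd_source x)] with y hy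
    by_cases hyx : y = x
    · subst hyx
      simpa using harmAt_const 0 y
    · simpa [poleGauge_of_ne hyx, poleGauge_self] using (harmAt_log_norm_crd hy hyx).neg
  · filter_upwards [isOpen_ne.mem_nhds hx] with y hy
    simpa [poleGauge_of_ne hx, poleGauge_of_ne hy] using harmAt_const 0 y

variable [T2Space X] [PreconnectedSpace X] {K : Set X}

/-- Outside a coordinate disc, subharmonic functions that are at most `1` on the disc and nonpositive
on the boundary of `K` are uniformly smaller than `1` on larger circles. -/
theorem IsSubsurfaceWithSmoothBoundary.exists_lt_one (hK : IsSubsurfaceWithSmoothBoundary K)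
    (hKc : IsCompact K) (hKi : IsPreconnected (interior K)) (hKb : ∃ ζ ∈ K, ζ ∉ interior K)
    {p : X} {r R R' : ℝ} (hr : 0 < r) (hrR : r < R) (hRR' : R < R')
    (ht : closedBall 0 R' ⊆ (crd p).target) (hd : cdisc p R' ⊆ interior K) {β : X → ℝ}
    (hβ1 : ∀ x, β x ≤ 1) (hβ0 : ∀ x, 0 ≤ β x) (hβ : ∀ x ∉ interior K, β x = 0) :
    ∃ θ < 1, 0 ≤ θ ∧ ∀ w ∈ perronClass (K \ odisc p r) (interior K \ cdisc p r) β (fun _ _ ↦ 0),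
      (∀ x ∈ K \ odisc p r, w x ≤ 1) ∧ ∀ x ∈ cdisc p R \ odisc p R, w x ≤ θ := by
  have hR : 0 < R := hr.trans hrR
  have hrt : closedBall 0 r ⊆ (crd p).target :=
    (closedBall_subset_closedBall (hrR.trans hRR').le).trans ht
  have hRt : closedBall 0 R ⊆ (crd p).target := (closedBall_subset_closedBall hRR'.le).trans ht
  have hrd : cdisc p r ⊆ interior K :=
    (image_mono (closedBall_subset_closedBall (hrR.trans hRR').le)).trans hd
  have hRd : cdisc p R ⊆ interior K := (image_mono (closedBall_subset_closedBall hRR'.le)).trans hd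
  obtain ⟨ζ, hζ, hζi⟩ := hKb
  set Kr := K \ odisc p r with hKr
  set U := interior K \ cdisc p r with hU
  have hUo : IsOpen U := isOpen_interior.sdiff (isCompact_cdisc hrt).isClosed
  have hKrc : IsCompact Kr := hKc.diff (isOpen_odisc hrt)
  have hUK : U ⊆ Kr := sdiff_subset_sdiff interior_subset (odisc_subset_cdisc p r)
  have hUne : U ≠ univ := fun h ↦ (h ▸ mem_univ p : p ∈ U).2
    (odisc_subset_cdisc p r (mem_odisc_self p hr))
  set W := perronClass Kr U β (fun _ _ ↦ 0) with hW
  have hWc : ∀ w ∈ W, ContinuousOn w Kr := fun w hw x hx ↦ by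
    by_cases hxU : x ∈ U
    · simpa using (hw.1 x hxU).1.continuousWithinAt
    · exact (hw.2 x hx hxU).1
  have hWs : ∀ w ∈ W, ∀ x ∈ U, SubAt w x := fun w hw x hx ↦ by simpa using (hw.1 x hx).2
  have hW1 : ∀ w ∈ W, ∀ x ∈ Kr, w x ≤ 1 := fun w hw ↦
    le_of_subAt hKrc hUo hUK hUne (hWc w hw) (hWs w hw) fun x hx hxU ↦
      (hw.2 x hx hxU).2.trans (hβ1 x)
  have h0W : (fun _ ↦ (0 : ℝ)) ∈ W :=
    ⟨fun x _ ↦ ⟨by simpa using continuousAt_const, by simpa using (harmAt_const 0 x).subAt⟩,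
      fun x _ _ ↦ ⟨continuousWithinAt_const, hβ0 x⟩⟩
  have : Nonempty W := ⟨⟨_, h0W⟩⟩
  have hbdd : ∀ x ∈ Kr, BddAbove (range fun w : W ↦ w.1 x) := fun x hx ↦ by
    refine ⟨1, ?_⟩
    rintro _ ⟨w, rfl⟩
    exact hW1 w.1 w.2 x hx
  set u : X → ℝ := fun x ↦ ⨆ w : W, w.1 x with hu
  have huh : ∀ x ∈ U, HarmAt u x := fun x hx ↦ by
    simpa using harmAt_iSup_perronClass hUo (isGauge_zero U) ⟨_, h0W⟩
      (fun x hx ↦ hbdd x (hUK hx)) hx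
  have hu1 : ∀ x ∈ Kr, u x ≤ 1 := fun x hx ↦ ciSup_le fun w ↦ hW1 w.1 w.2 x hx
  have hu0 : ∀ x ∈ Kr, 0 ≤ u x := fun x hx ↦ le_ciSup (hbdd x hx) ⟨_, h0W⟩
  have hwu : ∀ w ∈ W, ∀ x ∈ Kr, w x ≤ u x := fun w hw x hx ↦ le_ciSup (hbdd x hx) ⟨w, hw⟩
  set C := cdisc p R \ odisc p R with hC
  have hCc : IsCompact C := (isCompact_cdisc hRt).diff (isOpen_odisc hRt)
  have hCann : C ⊆ odisc p R' \ cdisc p r := by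
    rintro x ⟨h1, h2⟩
    rw [mem_cdisc hRt] at h1
    rw [mem_odisc hRt, not_and, not_lt] at h2
    rw [Set.mem_sdiff, mem_odisc ht, mem_cdisc hrt, not_and, not_le]
    exact ⟨⟨h1.1, h1.2.trans_lt hRR'⟩, fun h ↦ hrR.trans_le (h2 h)⟩
  have hannU : odisc p R' \ cdisc p r ⊆ U :=
    sdiff_subset_sdiff_left ((odisc_subset_cdisc p R').trans hd)
  rcases C.eq_empty_or_nonempty with hCe | hCne
  · exact ⟨0, zero_lt_one, le_rfl, fun w hw ↦ ⟨hW1 w hw, by simp [hCe]⟩⟩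
  obtain ⟨x₀, hx₀, hmax⟩ := hCc.exists_isMaxOn hCne
    fun x hx ↦ (huh x (hannU (hCann hx))).continuousAt.continuousWithinAt
  have hx₀K := hUK (hannU (hCann hx₀))
  refine ⟨u x₀, lt_of_le_of_ne (hu1 x₀ hx₀K) fun hx₀1 ↦ ?_, hu0 x₀ hx₀K, fun w hw ↦ ⟨hW1 w hw,
    fun x hx ↦ (hwu w hw x (hUK (hannU (hCann hx)))).trans (hmax hx)⟩⟩
  have hann : ∀ x ∈ odisc p R' \ cdisc p r, u x = 1 :=
    HarmAt.eqOn_of_isPreconnected ((isOpen_odisc ht).sdiff (isCompact_cdisc hrt).isClosed)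
      (isPreconnected_annulus hr ht) (fun x hx ↦ huh x (hannU hx))
      (fun x hx ↦ hu1 x (hUK (hannU hx))) (hCann hx₀) hx₀1
  -- Filling in the disc allows the connectedness of `interior K` to be used; `U` itself is not
  -- known to be connected.
  set A := {x ∈ U | u x = 1} ∪ odisc p R' with hA
  have hAo : IsOpen A := by
    refine isOpen_iff_mem_nhds.2 fun x hx ↦ ?_
    rcases hx with hx | hx
    · have hloc : IsLocalMax u x := by
        filter_upwards [hUo.mem_nhds hx.1] with y hy
        rw [hx.2]; exact hu1 y (hUK hy)
      filter_upwards [(huh x hx.1).eventually_eq_of_isLocalMax hloc, hUo.mem_nhds hx.1]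
        with y h1 h2 using Or.inl ⟨h2, h1.trans hx.2⟩
    · exact mem_of_superset ((isOpen_odisc ht).mem_nhds hx) subset_union_right
  have hA1 : ∀ x ∈ A, x ∉ cdisc p r → x ∈ U ∧ u x = 1 := by
    rintro x (hx | hx) hxr
    · exact hx
    · exact ⟨hannU ⟨hx, hxr⟩, hann x ⟨hx, hxr⟩⟩
  have hrR' : cdisc p r ⊆ odisc p R' :=
    image_mono (closedBall_subset_ball (hrR.trans hRR'))
  have hsub : interior K ⊆ A := by
    refine hKi.subset_of_closure_inter_subset hAo
      ⟨p, hrd (odisc_subset_cdisc p r (mem_odisc_self p hr)),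
        Or.inr (mem_odisc_self p (hR.trans hRR'))⟩ ?_
    rintro x ⟨hxc, hxK⟩
    by_cases hxr : x ∈ cdisc p r
    · exact Or.inr (hrR' hxr)
    · have hxU : x ∈ U := ⟨hxK, hxr⟩
      refine Or.inl ⟨hxU, ?_⟩
      have h1 : x ∈ closure (A ∩ (cdisc p r)ᶜ) := by
        rw [inter_comm]
        exact (isCompact_cdisc hrt).isClosed.isOpen_compl.inter_closure ⟨hxr, hxc⟩
      have hmem : u x ∈ closure {(1 : ℝ)} :=
        ((huh x hxU).continuousAt.continuousWithinAt).mem_closure h1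
          (fun y hy ↦ (hA1 y hy.1 hy.2).2)
      simpa using hmem
  have hζr : ζ ∉ cdisc p r := fun h ↦ hζi (hrd h)
  have hN : (cdisc p r)ᶜ ∈ 𝓝 ζ := (isCompact_cdisc hrt).isClosed.isOpen_compl.mem_nhds hζr
  -- The barrier at `ζ` forces `u ≤ 1 / 2` at interior points near `ζ`, against `u = 1`.
  obtain ⟨N', hN', hle⟩ := hK.exists_nhds_forall_le hKc hζ hζi hN 1 one_half_pos
  have hζc : ζ ∈ closure (interior K) := hK.subset_closure_interior hζ
  obtain ⟨x, ⟨hxN', hxr⟩, hxi⟩ := mem_closure_iff_nhds.1 hζc _ (inter_mem hN' hN)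
  have hsubK : K ∩ (cdisc p r)ᶜ ⊆ Kr := fun y hy ↦ ⟨hy.1, fun h ↦ hy.2 (odisc_subset_cdisc p r h)⟩
  have h1 : u x ≤ 1 / 2 := by
    refine ciSup_le fun w ↦ hle w.1 ((hWc w.1 w.2).mono hsubK)
      (fun y hy ↦ hWs w.1 w.2 y ⟨hy.1, hy.2⟩) (fun y hy ↦ hW1 w.1 w.2 y (hsubK hy))
      (fun y hy hyi ↦ ?_) x ⟨interior_subset hxi, hxN'⟩
    exact (w.2.2 y (hsubK hy) fun h ↦ hyi h.1).2.trans (hβ y hyi).le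
  rw [(hA1 x (hsub hxi) hxr).2] at h1
  norm_num at h1

end Green

/-! ### Existence of the Green's function -/

section GreenFunction

variable {X : Type*} [TopologicalSpace X] [ChartedSpace ℂ X] [IsManifold 𝓘(ℂ) ω X]
  [T2Space X] [PreconnectedSpace X] {K : Set X}

omit [IsManifold 𝓘(ℂ) ω X] [T2Space X] [PreconnectedSpace X] in
-- `r` bounds the hole, `R` carries the comparison circle, and `R'` leaves room for an open annulus
-- around that circle.
theorem exists_cdisc_chain {p : X} {N : Set X} (hN : N ∈ 𝓝 p) :
    ∃ r R R' : ℝ, 0 < r ∧ r < R ∧ R < R' ∧ closedBall 0 R' ⊆ (crd p).target ∧ cdisc p R' ⊆ N := by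
  obtain ⟨ρ, hρ, h1, h2⟩ := exists_cdisc_subset hN
  exact ⟨ρ / 3, ρ / 2, ρ, by linarith, by linarith, by linarith, h1, h2⟩

omit [PreconnectedSpace X] in
-- The witness is the positive part of `log (R / |z|)`, extended by zero, with the regularised value
-- `log R` at `p`. Its sign later makes the Green's function nonnegative.
theorem perronClass_pole_nonempty {p : X} {R : ℝ} (hR : 0 < R)
    (ht : closedBall 0 R ⊆ (crd p).target) (hd : cdisc p R ⊆ interior K) :
    ∃ v ∈ perronClass K (interior K) (fun _ ↦ 0) (poleGauge p), ∀ x, x ≠ p → 0 ≤ v x := by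
  classical
  set v : X → ℝ := fun x ↦ if x ∈ odisc p R then Real.log R - Real.log ‖crd p x‖ else 0 with hv
  have hpos : ∀ x ∈ (crd p).source, x ≠ p → 0 < ‖crd p x‖ := fun x hx hxp ↦
    norm_pos_iff.2 fun h ↦ hxp ((crd_eq_zero_iff hx).1 h)
  have hvmax : ∀ x ∈ (crd p).source, x ≠ p →
      v x = max (Real.log R - Real.log ‖crd p x‖) 0 := by
    intro x hx hxp
    by_cases hxR : x ∈ odisc p R
    · have h1 := ((mem_odisc ht).1 hxR).2
      have h2 := Real.log_lt_log (hpos x hx hxp) h1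
      simp only [hv, if_pos hxR]
      exact (max_eq_left (by linarith)).symm
    · have h1 : R ≤ ‖crd p x‖ := by
        rw [mem_odisc ht, not_and, not_lt] at hxR; exact hxR hx
      have h2 := Real.log_le_log hR h1
      simp only [hv, if_neg hxR]
      exact (max_eq_right (by linarith)).symm
  have hv0 : ∀ x, x ∉ (crd p).source → v x = 0 := fun x hx ↦
    if_neg fun h ↦ hx ((mem_odisc ht).1 h).1
  have hvout : ∀ x ∉ cdisc p R, ∀ᶠ y in 𝓝 x, v y = 0 := fun x hx ↦ by
    filter_upwards [(isCompact_cdisc ht).isClosed.isOpen_compl.mem_nhds hx] with y hy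
    exact if_neg fun h ↦ hy (odisc_subset_cdisc p R h)
  refine ⟨v, ⟨fun x hx ↦ ?_, fun x hx hxi ↦ ?_⟩, fun x hxp ↦ ?_⟩
  · by_cases hxp : x = p
    · subst hxp
      have h1 : ∀ᶠ y in 𝓝 x, v y + poleGauge x x y = Real.log R := by
        filter_upwards [(isOpen_odisc ht).mem_nhds (mem_odisc_self x hR)] with y hy
        simp [hv, hy, poleGauge_self]
      have h2 := (harmAt_const (Real.log R) x).congr h1
      exact ⟨h2.continuousAt, h2.subAt⟩
    · simp only [poleGauge_of_ne hxp, add_zero]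
      by_cases hxd : x ∈ cdisc p R
      · have hxs := ((mem_cdisc ht).1 hxd).1
        have h1 : ∀ᶠ y in 𝓝 x, v y = max (Real.log R - Real.log ‖crd p y‖) 0 := by
          filter_upwards [(crd p).open_source.mem_nhds hxs, isOpen_ne.mem_nhds hxp] with y h2 h3
          exact hvmax y h2 h3
        have h2 : HarmAt (fun y ↦ Real.log R - Real.log ‖crd p y‖) x :=
          (harmAt_const _ x).sub (harmAt_log_norm_crd hxs hxp)
        have h3 : ContinuousAt (fun y ↦ max (Real.log R - Real.log ‖crd p y‖) 0) x :=
          h2.continuousAt.max continuousAt_const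
        exact ⟨h3.congr
          (by filter_upwards [h1] with y hy using hy.symm),
          (h2.subAt.max (harmAt_const 0 x).subAt).congr h1⟩
      · have h2 := (harmAt_const 0 x).congr (hvout x hxd)
        exact ⟨h2.continuousAt, h2.subAt⟩
  · have h1 := hvout x fun h ↦ hxi (hd h)
    exact ⟨((harmAt_const 0 x).congr h1).continuousAt.continuousWithinAt, h1.self_of_nhds.le⟩
  · by_cases hxs : x ∈ (crd p).source
    · rw [hvmax x hxs hxp]; exact le_max_right _ _
    · exact (hv0 x hxs).ge

/-- Uniform bounds for the Perron class with a logarithmic pole. -/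
theorem IsSubsurfaceWithSmoothBoundary.exists_bound_perronClass_pole
    (hK : IsSubsurfaceWithSmoothBoundary K)
    (hKc : IsCompact K) (hKi : IsPreconnected (interior K)) (hKb : ∃ ζ ∈ K, ζ ∉ interior K)
    {p : X} {r R R' : ℝ} (hr : 0 < r) (hrR : r < R) (hRR' : R < R')
    (ht : closedBall 0 R' ⊆ (crd p).target) (hd : cdisc p R' ⊆ interior K) :
    ∃ B C : ℝ, ∀ v ∈ perronClass K (interior K) (fun _ ↦ 0) (poleGauge p),
      (∀ x ∈ K, x ∉ odisc p r → v x ≤ B) ∧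
        ∀ x ∈ cdisc p R, v x + Real.log ‖crd p x‖ ≤ C := by
  classical
  have hR : 0 < R := hr.trans hrR
  have hrt : closedBall 0 r ⊆ (crd p).target :=
    (closedBall_subset_closedBall (hrR.trans hRR').le).trans ht
  have hRt : closedBall 0 R ⊆ (crd p).target := (closedBall_subset_closedBall hRR'.le).trans ht
  have hrRd : cdisc p r ⊆ cdisc p R := image_mono (closedBall_subset_closedBall hrR.le)
  have hRd : cdisc p R ⊆ interior K := (image_mono (closedBall_subset_closedBall hRR'.le)).trans hd
  obtain ⟨θ, hθ1, hθ0, hθ⟩ := hK.exists_lt_one hKc hKi hKb hr hrR hRR' ht hd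
    (β := fun x ↦ if x ∈ cdisc p r then 1 else 0) (fun x ↦ by split_ifs <;> norm_num)
    (fun x ↦ by split_ifs <;> norm_num) (fun x hx ↦ if_neg fun h ↦ hx (hRd (hrRd h)))
  -- If `T > 0` is the maximum of `v` on the circle of radius `r`, then `v ≤ θ * T` on the circle of
  -- radius `R`. The maximum principle for `v + log |z|` gives `T + log r ≤ θ * T + log R`, that is
  -- `T ≤ T₀`.
  set T₀ := (Real.log R - Real.log r) / (1 - θ) with hT₀
  have hlog : Real.log r < Real.log R := Real.log_lt_log hr hrR
  have hT₀0 : 0 < T₀ := div_pos (by linarith) (by linarith)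
  refine ⟨T₀, θ * T₀ + Real.log R, fun v hv ↦ ?_⟩
  have hpr : p ∈ odisc p r := mem_odisc_self p hr
  have hvU : ∀ x ∈ interior K, x ≠ p → ContinuousAt v x ∧ SubAt v x := fun x hx hxp ↦ by
    simpa [poleGauge_of_ne hxp] using hv.1 x hx
  have hvK : ∀ x ∈ K, x ≠ p → ContinuousWithinAt v K x := fun x hx hxp ↦ by
    by_cases hxi : x ∈ interior K
    · exact (hvU x hxi hxp).1.continuousWithinAt
    · exact (hv.2 x hx hxi).1
  have hvs : ∀ x ∈ cdisc p R, ContinuousAt (fun y ↦ v y + Real.log ‖crd p y‖) x ∧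
      SubAt (fun y ↦ v y + Real.log ‖crd p y‖) x := fun x hx ↦ by
    by_cases hxp : x = p
    · subst hxp
      simpa [poleGauge_self] using hv.1 x (hRd hx)
    · have h1 := hvU x (hRd hx) hxp
      have h2 := harmAt_log_norm_crd ((mem_cdisc hRt).1 hx).1 hxp
      exact ⟨h1.1.add h2.continuousAt, h1.2.add_harm h2⟩
  have hscale : ∀ T : ℝ, 0 < T → (∀ x ∈ cdisc p r \ odisc p r, v x ≤ T) →
      (∀ x ∈ K, x ∉ odisc p r → v x ≤ T) ∧
        ∀ x ∈ cdisc p R, v x + Real.log ‖crd p x‖ ≤ θ * T + Real.log R := by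
    intro T hT hvT
    have hne : ∀ x ∉ odisc p r, x ≠ p := fun x hx h ↦ hx (h ▸ hpr)
    have hw : (fun x ↦ T⁻¹ * v x) ∈ perronClass (K \ odisc p r) (interior K \ cdisc p r)
        (fun x ↦ if x ∈ cdisc p r then 1 else 0) (fun _ _ ↦ 0) := by
      refine ⟨fun x hx ↦ ?_, fun x hx hxU ↦ ⟨?_, ?_⟩⟩
      · have hxp := hne x fun h ↦ hx.2 (odisc_subset_cdisc p r h)
        simp only [add_zero]
        exact ⟨(hvU x hx.1 hxp).1.const_mul _, (hvU x hx.1 hxp).2.const_mul (inv_pos.2 hT)⟩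
      · exact ((hvK x hx.1 (hne x hx.2)).mono sdiff_subset).const_mul _
      · by_cases hxr : x ∈ cdisc p r
        · simp only [if_pos hxr]
          rw [inv_mul_le_iff₀ hT, mul_one]
          exact hvT x ⟨hxr, hx.2⟩
        · simp only [if_neg hxr]
          have hxi : x ∉ interior K := fun h ↦ hxU ⟨h, hxr⟩
          exact mul_nonpos_of_nonneg_of_nonpos (inv_nonneg.2 hT.le) (hv.2 x hx.1 hxi).2
    obtain ⟨h1, h2⟩ := hθ _ hw
    refine ⟨fun x hx hxo ↦ ?_, ?_⟩
    · have := h1 x ⟨hx, hxo⟩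
      rwa [inv_mul_le_iff₀ hT, mul_one] at this
    · refine le_of_subAt (isCompact_cdisc hRt) (isOpen_odisc hRt) (odisc_subset_cdisc p R)
        (odisc_ne_univ hR hRt) (fun x hx ↦ (hvs x hx).1.continuousWithinAt)
        (fun x hx ↦ (hvs x (odisc_subset_cdisc p R hx)).2) fun x hx hxo ↦ ?_
      have h3 := h2 x ⟨hx, hxo⟩
      rw [inv_mul_le_iff₀ hT] at h3
      have h4 : ‖crd p x‖ ≤ R := ((mem_cdisc hRt).1 hx).2
      have h5 : R ≤ ‖crd p x‖ := by
        rw [mem_odisc hRt, not_and, not_lt] at hxo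
        exact hxo ((mem_cdisc hRt).1 hx).1
      rw [le_antisymm h4 h5]
      linarith
  have hCc : IsCompact (cdisc p r \ odisc p r) := (isCompact_cdisc hrt).diff (isOpen_odisc hrt)
  have hsph : ∀ x ∈ cdisc p r \ odisc p r, v x ≤ T₀ := by
    intro x hx
    obtain ⟨x₁, hx₁, hmax⟩ := hCc.exists_isMaxOn ⟨x, hx⟩ (f := v) fun y hy ↦
      (hvU y (hRd (hrRd hy.1)) fun h ↦ hy.2 (h ▸ hpr)).1.continuousWithinAt
    refine (hmax hx).trans ?_
    rcases le_or_gt (v x₁) 0 with hneg | hT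
    · exact hneg.trans hT₀0.le
    · have h1 := (hscale (v x₁) hT fun y hy ↦ hmax hy).2 x₁ (hrRd hx₁.1)
      have h4 : ‖crd p x₁‖ ≤ r := ((mem_cdisc hrt).1 hx₁.1).2
      have h5 : r ≤ ‖crd p x₁‖ := by
        have := hx₁.2
        rw [mem_odisc hrt, not_and, not_lt] at this
        exact this ((mem_cdisc hrt).1 hx₁.1).1
      rw [le_antisymm h4 h5] at h1
      rw [hT₀, le_div_iff₀ (by linarith)]
      linarith
  exact hscale T₀ hT₀0 hsph

/-- Existence of the Green's function of the interior of a compact sub-surface with boundary. -/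
theorem IsSubsurfaceWithSmoothBoundary.exists_green (hK : IsSubsurfaceWithSmoothBoundary K)
    (hKc : IsCompact K) (hKi : IsPreconnected (interior K)) (hKb : ∃ ζ ∈ K, ζ ∉ interior K)
    {p : X} (hp : p ∈ interior K) :
    ∃ u : X → ℝ, (∀ x ∈ interior K, x ≠ p → HarmAt u x) ∧
      HarmAt (fun x ↦ u x + Real.log ‖crd p x‖) p ∧ (∀ x ∈ interior K, x ≠ p → 0 ≤ u x) ∧
      ∀ ζ ∈ K, ζ ∉ interior K → ∀ ε > 0, ∃ N ∈ 𝓝 ζ, ∀ x ∈ K ∩ N, u x ≤ ε := by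
  obtain ⟨r, R, R', hr, hrR, hRR', ht, hd⟩ := exists_cdisc_chain (isOpen_interior.mem_nhds hp)
  have hR : 0 < R := hr.trans hrR
  have hrt : closedBall 0 r ⊆ (crd p).target :=
    (closedBall_subset_closedBall (hrR.trans hRR').le).trans ht
  have hRt : closedBall 0 R ⊆ (crd p).target := (closedBall_subset_closedBall hRR'.le).trans ht
  have hrd : cdisc p r ⊆ interior K :=
    (image_mono (closedBall_subset_closedBall (hrR.trans hRR').le)).trans hd
  have hRd : cdisc p R ⊆ interior K := (image_mono (closedBall_subset_closedBall hRR'.le)).trans hd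
  obtain ⟨v₀, hv₀, hv₀0⟩ := perronClass_pole_nonempty hR hRt hRd
  obtain ⟨B, C, hBC⟩ := hK.exists_bound_perronClass_pole hKc hKi hKb hr hrR hRR' ht hd
  set P := perronClass K (interior K) (fun _ ↦ (0 : ℝ)) (poleGauge p) with hP
  have : Nonempty P := ⟨⟨v₀, hv₀⟩⟩
  have hbdd : ∀ x ∈ K, BddAbove (range fun v : P ↦ v.1 x) := fun x hx ↦ by
    by_cases hxr : x ∈ odisc p r
    · refine ⟨C - Real.log ‖crd p x‖, ?_⟩
      rintro _ ⟨v, rfl⟩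
      have := (hBC v.1 v.2).2 x
        (image_mono (ball_subset_closedBall.trans (closedBall_subset_closedBall hrR.le)) hxr)
      simp only
      linarith
    · refine ⟨B, ?_⟩
      rintro _ ⟨v, rfl⟩
      exact (hBC v.1 v.2).1 x hx hxr
  have hharm := fun x (hx : x ∈ interior K) ↦ harmAt_iSup_perronClass isOpen_interior
    (isGauge_poleGauge (interior K) p) ⟨v₀, hv₀⟩ (fun x hx ↦ hbdd x (interior_subset hx)) hx
  refine ⟨fun x ↦ ⨆ v : P, v.1 x, fun x hx hxp ↦ ?_, ?_, fun x hx hxp ↦ ?_,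
    fun ζ hζ hζi ε hε ↦ ?_⟩
  · simpa [poleGauge_of_ne hxp] using hharm x hx
  · simpa [poleGauge_self] using hharm p hp
  · exact (hv₀0 x hxp).trans (le_ciSup (hbdd x (interior_subset hx)) ⟨v₀, hv₀⟩)
  · have hN : (cdisc p r)ᶜ ∈ 𝓝 ζ :=
      (isCompact_cdisc hrt).isClosed.isOpen_compl.mem_nhds fun h ↦ hζi (hrd h)
    obtain ⟨N', hN', hle⟩ := hK.exists_nhds_forall_le hKc hζ hζi hN B hε
    refine ⟨N', hN', fun x hx ↦ ciSup_le fun v ↦ ?_⟩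
    have hne : ∀ y ∉ cdisc p r, y ≠ p := fun y hy h ↦
      hy (h ▸ odisc_subset_cdisc p r (mem_odisc_self p hr))
    have hvU : ∀ x ∈ interior K, x ≠ p → ContinuousAt v.1 x ∧ SubAt v.1 x := fun x hx hxp ↦ by
      simpa [poleGauge_of_ne hxp] using v.2.1 x hx
    refine hle v.1 (fun y hy ↦ ?_) (fun y hy ↦ (hvU y hy.1 (hne y hy.2)).2)
      (fun y hy ↦ (hBC v.1 v.2).1 y hy.1 fun h ↦ hy.2 (odisc_subset_cdisc p r h))
      (fun y hy hyi ↦ (v.2.2 y hy.1 hyi).2) x hx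
    by_cases hyi : y ∈ interior K
    · exact (hvU y hyi (hne y hy.2)).1.continuousWithinAt
    · exact (v.2.2 y hy.1 hyi).1.mono inter_subset_left

end GreenFunction

/-! ### Pushing a sub-surface into its interior -/

section Push

open scoped unitInterval

variable {X : Type*} [TopologicalSpace X]

/-- There is a homotopy from the identity that preserves `K` and its interior, and at time `1`
either fixes points of `K` or moves them to the interior, the latter for all points of `s`. -/
def PushesInto (K s : Set X) : Prop :=
  ∃ H : C(I × X, X), (∀ x, H (0, x) = x) ∧ (∀ t, ∀ x ∈ K, H (t, x) ∈ K) ∧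
    (∀ t, ∀ x ∈ interior K, H (t, x) ∈ interior K) ∧
    (∀ x ∈ K, H (1, x) ∈ interior K ∨ H (1, x) = x) ∧ ∀ x ∈ s, x ∈ K → H (1, x) ∈ interior K

theorem pushesInto_of_subset_interior {K s : Set X} (hs : s ⊆ interior K) : PushesInto K s :=
  ⟨⟨Prod.snd, continuous_snd⟩, fun _ ↦ rfl, fun _ _ h ↦ h, fun _ _ h ↦ h, fun _ _ ↦ Or.inr rfl,
    fun _ h _ ↦ hs h⟩

/-- The two homotopies are composed at each time. A point not yet interior after the first has not
moved, so the second still acts on it as required. -/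
theorem PushesInto.union {K s t : Set X} (hs : PushesInto K s) (ht : PushesInto K t) :
    PushesInto K (s ∪ t) := by
  obtain ⟨H, h0, h1, h2, h3, h4⟩ := hs
  obtain ⟨G, g0, g1, g2, g3, g4⟩ := ht
  refine ⟨⟨fun q ↦ G (q.1, H q), by fun_prop⟩, fun x ↦ by simp [h0, g0],
    fun t x hx ↦ g1 t _ (h1 t x hx), fun t x hx ↦ g2 t _ (h2 t x hx), fun x hx ↦ ?_,
    fun x hx hxK ↦ ?_⟩
  · rcases h3 x hx with h | h
    · exact Or.inl (g2 1 _ h)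
    · simpa [h] using g3 x hx
  · rcases h3 x hxK with h | h
    · exact g2 1 _ h
    · rcases hx with hx | hx
      · exact g2 1 _ (h4 x hx hxK)
      · simpa [h] using g4 x hx hxK

theorem pushesInto_chart [T2Space X] {K : Set X} {e : OpenPartialHomeomorph X ℂ}
    (heK : ∀ x ∈ e.source, x ∈ K ↔ 0 ≤ (e x).im) {ζ : X} (hζ : ζ ∈ e.source) :
    ∃ s ∈ 𝓝 ζ, PushesInto K s := by
  classical
  obtain ⟨r, hr, hrt⟩ := Metric.nhds_basis_closedBall.mem_iff.1
    (e.open_target.mem_nhds (e.map_source hζ))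
  -- The upward shift at `z` is at most the distance to the circle of radius `r`, so points of the
  -- ball stay in it and all others are fixed.
  set ρ : ℂ → ℝ := fun z ↦ max 0 (r - ‖z - e ζ‖) with hρ
  have hρc : Continuous ρ := by fun_prop
  have hρ0 : ∀ z, 0 ≤ ρ z := fun z ↦ le_max_left _ _
  set g : I → ℂ → ℂ := fun t z ↦ z + ((t : ℝ) * ρ z : ℝ) * Complex.I with hg
  have him : ∀ t z, (g t z).im = z.im + t * ρ z := fun t z ↦ by simp [hg]
  have hgt : ∀ t, ∀ z ∈ e.target, g t z ∈ e.target := by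
    intro t z hz
    rcases (hρ0 z).eq_or_lt with h | h
    · simpa [hg, ← h] using hz
    · refine hrt ?_
      have h1 : ρ z = r - ‖z - e ζ‖ := by
        rcases max_choice 0 (r - ‖z - e ζ‖) with h2 | h2
        · exact absurd h2 h.ne'
        · exact h2
      have h2 : g t z - e ζ = (z - e ζ) + (((t : ℝ) * ρ z : ℝ) : ℂ) * Complex.I := by
        simp only [hg]; ring
      rw [mem_closedBall, dist_eq_norm, h2]
      refine (norm_add_le _ _).trans ?_
      have h3 : ‖(((t : ℝ) * ρ z : ℝ) : ℂ) * Complex.I‖ = t * ρ z := by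
        rw [norm_mul, Complex.norm_I, mul_one, Complex.norm_real, Real.norm_of_nonneg
          (mul_nonneg t.2.1 (hρ0 z))]
      rw [h3]
      have h4 : (t : ℝ) * ρ z ≤ 1 * ρ z := mul_le_mul_of_nonneg_right t.2.2 (hρ0 z)
      linarith
  set H : I × X → X := fun q ↦ if q.2 ∈ e.source then e.symm (g q.1 (e q.2)) else q.2 with hH
  have hHs : ∀ t, ∀ x ∈ e.source, H (t, x) = e.symm (g t (e x)) := fun t x hx ↦ if_pos hx
  have hHid : ∀ t : I, ∀ x, (t : ℝ) * ρ (e x) = 0 → H (t, x) = x := by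
    intro t x h
    by_cases hx : x ∈ e.source
    · rw [hHs t x hx]
      simp only [hg, h, Complex.ofReal_zero, zero_mul, add_zero, e.left_inv hx]
    · exact if_neg hx
  -- The moved points lie in a set closed in all of `X`, which makes the extension by the identity
  -- continuous.
  have hDc : IsClosed (e.symm '' closedBall (e ζ) r) :=
    ((isCompact_closedBall _ _).image_of_continuousOn (e.continuousOn_symm.mono hrt)).isClosed
  have hHout : ∀ t, ∀ x ∉ e.symm '' closedBall (e ζ) r, H (t, x) = x := by
    intro t x hx
    by_cases hxs : x ∈ e.source
    · refine hHid t x ?_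
      have : r - ‖e x - e ζ‖ ≤ 0 := by
        by_contra! hcon
        refine hx ⟨e x, ?_, e.left_inv hxs⟩
        rw [mem_closedBall, dist_eq_norm]; linarith
      simp [hρ, max_eq_left this]
    · exact if_neg hxs
  have hHc : Continuous H := by
    rw [continuous_iff_continuousAt]
    rintro ⟨t, x⟩
    by_cases hx : x ∈ e.source
    · have h1 : ContinuousAt (fun q : I × X ↦ e.symm (g q.1 (e q.2))) (t, x) := by
        refine ContinuousAt.comp (g := e.symm) (e.continuousAt_symm (hgt t _ (e.map_source hx))) ?_
        have h2 : ContinuousAt (fun q : I × X ↦ e q.2) (t, x) :=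
          ContinuousAt.comp (g := e) (e.continuousAt hx) continuousAt_snd
        have h3 : Continuous fun q : I × ℂ ↦ g q.1 q.2 := by
          simp only [hg]
          fun_prop
        exact ContinuousAt.comp (g := fun q : I × ℂ ↦ g q.1 q.2) h3.continuousAt
          (continuousAt_fst.prodMk h2)
      refine h1.congr ?_
      filter_upwards [continuousAt_snd.eventually (e.open_source.mem_nhds hx)] with q hq
      exact (hHs q.1 q.2 hq).symm
    · have h1 : x ∉ e.symm '' closedBall (e ζ) r := by
        rintro ⟨z, hz, rfl⟩
        exact hx (e.map_target (hrt hz))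
      refine continuousAt_snd.congr ?_
      filter_upwards [continuousAt_snd.eventually (hDc.isOpen_compl.mem_nhds h1)] with q hq
      exact (hHout q.1 q.2 hq).symm
  have hint : ∀ t : I, ∀ x ∈ e.source, x ∈ K → 0 < (t : ℝ) * ρ (e x) → H (t, x) ∈ interior K := by
    intro t x hx hxK hpos
    rw [hHs t x hx]
    have h1 := hgt t _ (e.map_source hx)
    have h2 := e.map_target h1
    have h3 : 0 < (e (e.symm (g t (e x)))).im := by
      rw [e.right_inv h1, him]
      have := (heK x hx).1 hxK
      linarith
    by_contra hni
    exact h3.ne' (im_eq_zero_of_notMem_interior heK h2 ((heK _ h2).2 h3.le) hni)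
  have hor : ∀ t, ∀ x ∈ K, H (t, x) ∈ interior K ∨ H (t, x) = x := by
    intro t x hxK
    by_cases hx : x ∈ e.source
    · rcases (mul_nonneg t.2.1 (hρ0 (e x))).eq_or_lt with h | h
      · exact Or.inr (hHid t x h.symm)
      · exact Or.inl (hint t x hx hxK h)
    · exact Or.inr (if_neg hx)
  refine ⟨e.source ∩ e ⁻¹' ball (e ζ) r, inter_mem (e.open_source.mem_nhds hζ)
    ((e.continuousAt hζ) (ball_mem_nhds _ hr)), ⟨H, hHc⟩, fun x ↦ hHid 0 x (by simp),
    fun t x hx ↦ ?_, fun t x hx ↦ ?_, hor 1, fun x hx hxK ↦ hint 1 x hx.1 hxK ?_⟩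
  · rcases hor t x hx with h | h
    · exact interior_subset h
    · exact mem_of_eq_of_mem h hx
  · rcases hor t x (interior_subset hx) with h | h
    · exact h
    · exact mem_of_eq_of_mem h hx
  · have : ‖e x - e ζ‖ < r := by simpa [dist_eq_norm] using hx.2
    have h2 : 0 < ρ (e x) := lt_max_of_lt_right (by linarith)
    simpa using h2

variable [ChartedSpace ℂ X] [T2Space X]

theorem IsSubsurfaceWithSmoothBoundary.pushesInto {K : Set X}
    (hK : IsSubsurfaceWithSmoothBoundary K) (hKc : IsCompact K) : PushesInto K K := by
  refine hKc.induction_on (p := PushesInto K) (pushesInto_of_subset_interior (empty_subset _)) ?_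
    (fun s t hs ht ↦ hs.union ht) fun x hx ↦ ?_
  · rintro s t hst ⟨H, h0, h1, h2, h3, h4⟩
    exact ⟨H, h0, h1, h2, h3, fun x hx ↦ h4 x (hst hx)⟩
  · obtain ⟨e, _, hxe, heK⟩ := hK x hx
    obtain ⟨s, hs, hp⟩ := pushesInto_chart heK hxe
    exact ⟨s, mem_nhdsWithin_of_mem_nhds hs, hp⟩

/-- A compact sub-surface is homotopy equivalent to its interior. -/
theorem IsSubsurfaceWithSmoothBoundary.simplyConnectedSpace_interior {K : Set X}
    (hK : IsSubsurfaceWithSmoothBoundary K) (hKc : IsCompact K) [SimplyConnectedSpace K] :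
    SimplyConnectedSpace (interior K) := by
  obtain ⟨H, h0, h1, h2, -, h4⟩ := hK.pushesInto hKc
  let i : C(interior K, K) := ⟨fun x ↦ ⟨x, interior_subset x.2⟩, by fun_prop⟩
  let h : C(K, interior K) := ⟨fun x ↦ ⟨H (1, x), h4 x x.2 x.2⟩, by fun_prop⟩
  let F : (ContinuousMap.id (interior K)).Homotopy (h.comp i) :=
    { toFun := fun q ↦ ⟨H (q.1, q.2), h2 q.1 q.2 q.2.2⟩
      continuous_toFun := by fun_prop
      map_zero_left := fun x ↦ Subtype.ext (h0 x)
      map_one_left := fun x ↦ rfl }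
  let G : (ContinuousMap.id K).Homotopy (i.comp h) :=
    { toFun := fun q ↦ ⟨H (q.1, q.2), h1 q.1 q.2 q.2.2⟩
      continuous_toFun := by fun_prop
      map_zero_left := fun x ↦ Subtype.ext (h0 x)
      map_one_left := fun x ↦ rfl }
  exact ContinuousMap.HomotopyEquiv.simplyConnectedSpace
    ⟨i, h, ⟨F.symm⟩, ⟨G.symm⟩⟩

end Push

/-! ### Trivialising locally constant cocycles -/

/-- On a simply connected space, every locally constant cocycle is a coboundary. -/
theorem exists_coboundary_of_locally_constant_cocycle {Y ι G : Type*} [TopologicalSpace Y]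
    [SimplyConnectedSpace Y] [LocallyPathConnectedSpace Y] [Group G] {U : ι → Set Y}
    (hU : ∀ i, IsOpen (U i)) (idx : Y → ι) (hidx : ∀ y, y ∈ U (idx y)) {c : ι → ι → Y → G}
    (hself : ∀ i, ∀ y ∈ U i, c i i y = 1)
    (hcomp : ∀ i j k, ∀ y ∈ U i ∩ U j ∩ U k, c j k y * c i j y = c i k y)
    (hloc : ∀ i j, ∀ y ∈ U i ∩ U j, ∀ᶠ z in 𝓝 y, c i j z = c i j y) :
    ∃ b : ι → Y → G, (∀ i, ∀ y ∈ U i, ∀ᶠ z in 𝓝 y, b i z = b i y) ∧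
      ∀ i j, ∀ y ∈ U i ∩ U j, c i j y * b i y = b j y := by
  -- With discrete fibre `G` the cocycle glues to a covering of `Y`. Lifting the identity of the
  -- simply connected base gives a global section; its local coordinates are the `b i`.
  let : TopologicalSpace G := ⊥
  have : DiscreteTopology G := ⟨rfl⟩
  let Z : FiberBundleCore ι Y G :=
    { baseSet := U
      isOpen_baseSet := hU
      indexAt := idx
      mem_baseSet_at := hidx
      coordChange := fun i j y g ↦ c i j y * g
      coordChange_self := fun i y hy g ↦ by rw [hself i y hy, one_mul]
      continuousOn_coordChange := fun i j ↦ by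
        rintro ⟨y, g⟩ ⟨hy, -⟩
        have h1 : Tendsto (fun q : Y × G ↦ c i j q.1 * q.2) (𝓝 (y, g)) (pure (c i j y * g)) := by
          rw [tendsto_pure, nhds_prod_eq, nhds_discrete G]
          filter_upwards [(hloc i j y hy).prod_mk (mem_pure.2 rfl : ({g} : Set G) ∈ pure g)]
            with q hq
          have : q.2 = g := hq.2
          rw [hq.1, this]
        exact (h1.mono_right (pure_le_nhds _)).mono_left nhdsWithin_le_nhds
      coordChange_comp := fun i j k y hy g ↦ by rw [← mul_assoc, hcomp i j k y hy] }
  have hcov : IsCoveringMap (Bundle.TotalSpace.proj : Bundle.TotalSpace G Z.Fiber → Y) :=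
    FiberBundle.isCoveringMap
  obtain ⟨y₀⟩ : Nonempty Y := inferInstance
  obtain ⟨σ, ⟨-, hσ⟩, -⟩ := hcov.existsUnique_continuousMap_lifts (ContinuousMap.id Y) y₀
    (⟨y₀, (1 : G)⟩ : Bundle.TotalSpace G Z.Fiber) rfl
  have hσ' : ∀ y, (σ y).proj = y := fun y ↦ congrFun hσ y
  let s : Y → G := fun y ↦ (σ y).snd
  have hval : ∀ i y, (Z.localTriv i (σ y)).2 = c (idx y) i y * s y := fun i y ↦ by
    have : (Z.localTriv i (σ y)).2 = c (idx (σ y).proj) i (σ y).proj * s y := rfl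
    rw [this, hσ' y]
  refine ⟨fun i y ↦ (Z.localTriv i (σ y)).2, fun i y hy ↦ ?_, fun i j y hy ↦ ?_⟩
  · have hs : σ y ∈ (Z.localTriv i).source := by
      rw [Z.mem_localTriv_source, hσ' y]; exact hy
    have hc : ContinuousAt (fun z ↦ (Z.localTriv i (σ z)).2) y :=
      continuousAt_snd.comp (((Z.localTriv i).continuousAt hs).comp σ.continuous.continuousAt)
    have h1 := hc.tendsto
    rw [nhds_discrete G, tendsto_pure] at h1
    exact h1
  · simp only [hval]
    rw [← mul_assoc, hcomp (idx y) i j y ⟨⟨hidx y, hy.1⟩, hy.2⟩]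

/-! ### From the Green's function to a holomorphic function -/

section GreenMap

variable {X : Type*} [TopologicalSpace X] [ChartedSpace ℂ X]

theorem isPreconnected_odisc {p : X} {ρ : ℝ} (h : closedBall 0 ρ ⊆ (crd p).target) :
    IsPreconnected (odisc p ρ) :=
  (convex_ball (0 : ℂ) ρ).isPreconnected.image _
    ((crd p).continuousOn_symm.mono (ball_subset_closedBall.trans h))

variable [IsManifold 𝓘(ℂ) ω X]

/-- Two holomorphic functions with the same nonvanishing modulus have locally constant ratio. -/
theorem eventually_div_eq_of_norm_eq {f g : X → ℂ} {x : X}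
    (hf : ∀ᶠ y in 𝓝 x, MDifferentiableAt 𝓘(ℂ) 𝓘(ℂ) f y)
    (hg : ∀ᶠ y in 𝓝 x, MDifferentiableAt 𝓘(ℂ) 𝓘(ℂ) g y)
    (hfg : ∀ᶠ y in 𝓝 x, ‖f y‖ = ‖g y‖ ∧ g y ≠ 0) : ∀ᶠ y in 𝓝 x, f y / g y = f x / g x := by
  obtain ⟨ρ, hρ, ht, hN⟩ := exists_cdisc_subset (hf.and (hg.and hfg))
  have hN' : ∀ y ∈ odisc x ρ, _ := fun y hy ↦ hN (odisc_subset_cdisc x ρ hy)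
  have h1 : ∀ y ∈ odisc x ρ, ‖f y / g y‖ = 1 := fun y hy ↦ by
    obtain ⟨-, -, h2, h3⟩ := hN' y hy
    rw [norm_div, h2, div_self (norm_ne_zero_iff.2 h3)]
  have hd : MDifferentiableOn 𝓘(ℂ) 𝓘(ℂ) (fun y ↦ f y / g y) (odisc x ρ) := fun y hy ↦ by
    obtain ⟨h2, h3, -, h4⟩ := hN' y hy
    have h5 : MDifferentiableAt 𝓘(ℂ) 𝓘(ℂ) (fun y ↦ (g y)⁻¹) y :=
      DifferentiableAt.comp_mdifferentiableAt (g := fun w ↦ w⁻¹) (differentiableAt_inv h4) h3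
    simpa only [div_eq_mul_inv] using! (h2.mul h5).mdifferentiableWithinAt
  have hx : x ∈ odisc x ρ := mem_odisc_self x hρ
  have h2 := hd.eqOn_of_isPreconnected_of_isMaxOn_norm (isPreconnected_odisc ht) (isOpen_odisc ht)
    hx (fun y hy ↦ by simp only [mem_ofPred, Function.comp]; rw [h1 y hy, h1 x hx])
  filter_upwards [(isOpen_odisc ht).mem_nhds hx] with y hy using h2 hy

/-- A holomorphic function on a simply connected domain whose modulus is prescribed by a
Green's function. -/
theorem exists_holomorphic_of_green {Ω : Set X} (hΩ : IsOpen Ω) [SimplyConnectedSpace Ω] {p : X}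
    (hp : p ∈ Ω) [T2Space X] {u : X → ℝ} (hu : ∀ x ∈ Ω, x ≠ p → HarmAt u x)
    (hup : HarmAt (fun x ↦ u x + Real.log ‖crd p x‖) p) :
    ∃ f : X → ℂ, (∀ x ∈ Ω, MDifferentiableAt 𝓘(ℂ) 𝓘(ℂ) f x) ∧
      (∀ x ∈ Ω, x ≠ p → ‖f x‖ = Real.exp (-u x)) ∧
      ∃ G : X → ℂ, (∀ᶠ x in 𝓝 p, MDifferentiableAt 𝓘(ℂ) 𝓘(ℂ) G x) ∧ G p ≠ 0 ∧
        ∀ᶠ x in 𝓝 p, f x = crd p x * G x := by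
  classical
  have hlocal : ∀ x : Ω, ∃ (f : X → ℂ) (N : Set X), IsOpen N ∧ (x : X) ∈ N ∧
      (∀ y ∈ N, MDifferentiableAt 𝓘(ℂ) 𝓘(ℂ) f y) ∧
      (∀ y ∈ N, y ≠ p → ‖f y‖ = Real.exp (-u y)) ∧ (p ∈ N → (x : X) = p) ∧
      ((x : X) = p → ∃ G : X → ℂ, (∀ᶠ x in 𝓝 p, MDifferentiableAt 𝓘(ℂ) 𝓘(ℂ) G x) ∧ G p ≠ 0 ∧
        ∀ y, f y = crd p y * G y) := by
    rintro ⟨x, hx⟩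
    by_cases hxp : x = p
    · subst hxp
      obtain ⟨F, hF, huF⟩ := hup
      obtain ⟨N, hN, hNo, hxN⟩ := eventually_nhds_iff.1
        ((hF.and huF).and ((crd x).open_source.mem_nhds (mem_crd_source x)))
      have hexp : ∀ y ∈ N, MDifferentiableAt 𝓘(ℂ) 𝓘(ℂ) (fun y ↦ Complex.exp (-F y)) y :=
        fun y hy ↦ DifferentiableAt.comp_mdifferentiableAt (g := fun w ↦ Complex.exp (-w))
          (by fun_prop) (hN y hy).1.1
      refine ⟨fun y ↦ crd x y * Complex.exp (-F y), N, hNo, hxN, fun y hy ↦ ?_, fun y hy hyx ↦ ?_,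
        fun _ ↦ rfl, fun _ ↦ ⟨fun y ↦ Complex.exp (-F y), ?_, Complex.exp_ne_zero _,
          fun y ↦ rfl⟩⟩
      · exact (mdifferentiableAt_crd (hN y hy).2).mul (hexp y hy)
      · have h1 : 0 < ‖crd x y‖ := norm_pos_iff.2 fun h ↦ hyx ((crd_eq_zero_iff (hN y hy).2).1 h)
        have h2 := (hN y hy).1.2
        rw [norm_mul, Complex.norm_exp, Complex.neg_re, ← h2]
        nth_rw 1 [← Real.exp_log h1]
        rw [← Real.exp_add]
        ring_nf
      · filter_upwards [hNo.mem_nhds hxN] with y hy using hexp y hy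
    · obtain ⟨F, hF, huF⟩ := hu x hx hxp
      obtain ⟨N, hN, hNo, hxN⟩ := eventually_nhds_iff.1 ((hF.and huF).and (isOpen_ne.mem_nhds hxp))
      refine ⟨fun y ↦ Complex.exp (-F y), N, hNo, hxN, fun y hy ↦ ?_, fun y hy _ ↦ ?_,
        fun hpN ↦ absurd rfl (hN p hpN).2, fun h ↦ absurd h hxp⟩
      · exact DifferentiableAt.comp_mdifferentiableAt (g := fun w ↦ Complex.exp (-w))
          (by fun_prop) (hN y hy).1.1
      · rw [Complex.norm_exp, Complex.neg_re, (hN y hy).1.2]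
  choose f N hNo hxN hfd hfn hNp hG using hlocal
  have hNp' : ∀ i, p ∈ N i → i = ⟨p, hp⟩ := fun i hi ↦ Subtype.ext (hNp i hi)
  have hfp : ∀ i, p ∈ N i → f i p = 0 := fun i hi ↦ by
    obtain ⟨G, -, -, h⟩ := hG i (hNp i hi)
    rw [h p, crd_self, zero_mul]
  have hne : ∀ i, ∀ y ∈ N i, y ≠ p → f i y ≠ 0 := fun i y hy hyp h ↦ by
    have := hfn i y hy hyp
    rw [h, norm_zero] at this
    exact (Real.exp_pos _).ne this
  have : LocallyConnectedSpace X := ChartedSpace.locallyConnectedSpace ℂ X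
  have : LocallyPathConnectedSpace X := ChartedSpace.locallyPathConnectedSpace ℂ X
  have : LocallyPathConnectedSpace Ω := hΩ.locallyPathConnectedSpace
  -- At `p` the quotient is `0 / 0 = 0`, so the value is `1`. This is harmless: only the
  -- neighbourhood indexed by `p` contains `p`.
  let c : Ω → Ω → Ω → Circle := fun i j y ↦ if h : ‖f j y / f i y‖ = 1 then
    ⟨f j y / f i y, mem_sphere_zero_iff_norm.2 h⟩ else 1
  have hc : ∀ i j, ∀ y : Ω, (y : X) ∈ N i → (y : X) ∈ N j → (y : X) ≠ p →
      (c i j y : ℂ) = f j y / f i y := fun i j y hi hj hyp ↦ by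
    have h : ‖f j y / f i y‖ = 1 := by
      rw [norm_div, hfn i y hi hyp, hfn j y hj hyp, div_self (Real.exp_pos _).ne']
    have h2 : c i j y = ⟨f j y / f i y, mem_sphere_zero_iff_norm.2 h⟩ := dif_pos h
    rw [h2]
  have hcp : ∀ i j, ∀ y : Ω, (y : X) ∈ N i → (y : X) ∈ N j → (y : X) = p → c i j y = 1 :=
    fun i j y hi hj hyp ↦ by
      have h : ¬ ‖f j y / f i y‖ = 1 := by
        rw [hyp] at hi hj ⊢
        simp [hfp i hi]
      exact dif_neg h
  have hself : ∀ i, ∀ y : Ω, (y : X) ∈ N i → c i i y = 1 := fun i y hy ↦ by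
    by_cases hyp : (y : X) = p
    · exact hcp i i y hy hy hyp
    · refine Circle.ext ?_
      rw [hc i i y hy hy hyp, div_self (hne i y hy hyp), Circle.coe_one]
  obtain ⟨b, hb1, hb2⟩ := exists_coboundary_of_locally_constant_cocycle
    (U := fun i : Ω ↦ ((↑) : Ω → X) ⁻¹' N i) (fun i ↦ (hNo i).preimage continuous_subtype_val)
    id (fun y ↦ hxN y) (c := c) hself
    (fun i j k y ⟨⟨hi, hj⟩, hk⟩ ↦ by
      by_cases hyp : (y : X) = p
      · rw [hcp i j y hi hj hyp, hcp j k y hj hk hyp, hcp i k y hi hk hyp, one_mul]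
      · refine Circle.ext ?_
        rw [Circle.coe_mul, hc i j y hi hj hyp, hc j k y hj hk hyp, hc i k y hi hk hyp]
        field_simp [hne i y hi hyp, hne j y hj hyp])
    (fun i j y ⟨hi, hj⟩ ↦ by
      by_cases hyp : (y : X) = p
      · have hij : i = j := by
          rw [hNp' i (by simpa [hyp] using hi), hNp' j (by simpa [hyp] using hj)]
        subst hij
        filter_upwards [((hNo i).preimage continuous_subtype_val).mem_nhds hi] with z hz
        rw [hself i z hz, hself i y hi]
      · have hV : ∀ᶠ z in 𝓝 (y : X), z ∈ N i ∧ z ∈ N j ∧ z ≠ p :=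
          inter_mem ((hNo i).mem_nhds hi) (inter_mem ((hNo j).mem_nhds hj) (isOpen_ne.mem_nhds hyp))
        have h1 : ∀ᶠ z in 𝓝 (y : X), f j z / f i z = f j y / f i y :=
          eventually_div_eq_of_norm_eq (hV.mono fun z hz ↦ hfd j z hz.2.1)
            (hV.mono fun z hz ↦ hfd i z hz.1)
            (hV.mono fun z hz ↦ ⟨by rw [hfn j z hz.2.1 hz.2.2, hfn i z hz.1 hz.2.2],
              hne i z hz.1 hz.2.2⟩)
        filter_upwards [continuous_subtype_val.continuousAt.eventually h1,
          continuous_subtype_val.continuousAt.eventually hV] with z h2 h3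
        refine Circle.ext ?_
        rw [hc i j z h3.1 h3.2.1 h3.2.2, hc i j y hi hj hyp, h2])
  let g : X → ℂ := fun x ↦ if h : x ∈ Ω then f ⟨x, h⟩ x / (b ⟨x, h⟩ ⟨x, h⟩ : ℂ) else 0
  have hgi : ∀ i, ∀ y : Ω, (y : X) ∈ N i → g y = f i y / (b i y : ℂ) := fun i y hy ↦ by
    have h1 : g y = f y y / (b y y : ℂ) := by simp [g]
    rw [h1]
    by_cases hyp : (y : X) = p
    · have : y = i := by rw [hNp' i (by simpa [hyp] using hy)]; exact Subtype.ext hyp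
      rw [this]
    · have h2 := hb2 i y y ⟨hy, hxN y⟩
      rw [← h2, Circle.coe_mul, hc i y y hy (hxN y) hyp]
      have := hne i y hy hyp
      have := hne y y (hxN y) hyp
      have := (b i y).coe_ne_zero
      field_simp
  have hgloc : ∀ y : Ω, ∀ᶠ z in 𝓝 (y : X), g z = f y z * (b y y : ℂ)⁻¹ := fun y ↦ by
    have h1 : ∀ᶠ z : Ω in 𝓝 y, g z = f y z * (b y y : ℂ)⁻¹ := by
      filter_upwards [hb1 y y (hxN y),
        ((hNo y).preimage continuous_subtype_val).mem_nhds (hxN y)] with z h2 h3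
      rw [hgi y z h3, h2, div_eq_mul_inv]
    rw [← hΩ.isOpenEmbedding_subtypeVal.map_nhds_eq y]
    exact h1
  refine ⟨g, fun x hx ↦ ?_, fun x hx hxp ↦ ?_, ?_⟩
  · exact ((hfd ⟨x, hx⟩ x (hxN ⟨x, hx⟩)).mul mdifferentiableAt_const).congr_of_eventuallyEq
      (hgloc ⟨x, hx⟩)
  · rw [hgi ⟨x, hx⟩ ⟨x, hx⟩ (hxN ⟨x, hx⟩), norm_div, Circle.norm_coe, div_one]
    exact hfn ⟨x, hx⟩ x (hxN ⟨x, hx⟩) hxp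
  · obtain ⟨G, hG1, hG2, hG3⟩ := hG ⟨p, hp⟩ rfl
    refine ⟨fun z ↦ G z * (b ⟨p, hp⟩ ⟨p, hp⟩ : ℂ)⁻¹, ?_,
      mul_ne_zero hG2 (inv_ne_zero (Circle.coe_ne_zero _)), ?_⟩
    · filter_upwards [hG1] with z hz using hz.mul mdifferentiableAt_const
    · filter_upwards [hgloc ⟨p, hp⟩] with z hz
      rw [hz, hG3, mul_assoc]

end GreenMap

/-! ### Green maps: Schwarz's lemma, injectivity, immersion -/

section DiscMap

variable {X : Type*} [TopologicalSpace X] [ChartedSpace ℂ X] [IsManifold 𝓘(ℂ) ω X]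

theorem eventually_differentiableAt_comp_crd_symm {f : X → ℂ} {q : X}
    (hf : ∀ᶠ y in 𝓝 q, MDifferentiableAt 𝓘(ℂ) 𝓘(ℂ) f y) :
    ∀ᶠ z in 𝓝 (0 : ℂ), DifferentiableAt ℂ (f ∘ (crd q).symm) z := by
  have h0 := zero_mem_crd_target q
  have hc := ((crd q).continuousAt_symm h0).tendsto
  rw [crd_symm_zero] at hc
  filter_upwards [hc.eventually hf, (crd q).open_target.mem_nhds h0] with z h1 h2
  exact mdifferentiableAt_iff_differentiableAt.1
    (h1.comp z (mdifferentiableAt_crd_symm h2))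

/-- A holomorphic function vanishing at `q` is divisible by the centred chart at `q`. -/
theorem exists_eq_crd_mul {f : X → ℂ} {q : X}
    (hf : ∀ᶠ y in 𝓝 q, MDifferentiableAt 𝓘(ℂ) 𝓘(ℂ) f y) (hq : f q = 0) :
    ∃ G : X → ℂ, (∀ᶠ y in 𝓝 q, MDifferentiableAt 𝓘(ℂ) 𝓘(ℂ) G y) ∧
      ∀ᶠ y in 𝓝 q, f y = crd q y * G y := by
  have h1 := eventually_differentiableAt_comp_crd_symm hf
  set F := f ∘ (crd q).symm with hF
  obtain ⟨s, hs, hso, h0⟩ := _root_.eventually_nhds_iff.1 h1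
  have h2 : DifferentiableOn ℂ (dslope F 0) s :=
    (Complex.differentiableOn_dslope (hso.mem_nhds h0)).2
      fun z hz ↦ (hs z hz).differentiableWithinAt
  have hsrc := (crd q).open_source.mem_nhds (mem_crd_source q)
  have hc := (crd q).continuousAt (mem_crd_source q)
  have hmem : ∀ᶠ y in 𝓝 q, crd q y ∈ s := hc (by rw [crd_self]; exact hso.mem_nhds h0)
  refine ⟨fun y ↦ dslope F 0 (crd q y), ?_, ?_⟩
  · filter_upwards [hsrc, hmem] with y hy hys
    exact DifferentiableAt.comp_mdifferentiableAt (h2.differentiableAt (hso.mem_nhds hys))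
      (mdifferentiableAt_crd hy)
  · filter_upwards [hsrc] with y hy
    have h3 := sub_smul_dslope F 0 (crd q y)
    rw [sub_zero, smul_eq_mul] at h3
    rw [h3, hF]
    simp [crd_symm_zero, hq, (crd q).left_inv hy]

/-- `f` maps the domain `Ω` properly to the unit disc, with a single, simple zero at `p`. -/
structure IsGreenMap (Ω : Set X) (p : X) (f : X → ℂ) : Prop where
  mdiff : ∀ x ∈ Ω, MDifferentiableAt 𝓘(ℂ) 𝓘(ℂ) f x
  map_self : f p = 0
  ne_zero : ∀ x ∈ Ω, x ≠ p → f x ≠ 0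
  norm_lt : ∀ x ∈ Ω, ‖f x‖ < 1
  proper : ∀ c < 1, IsCompact {x ∈ Ω | ‖f x‖ ≤ c}
  simple : ∃ G : X → ℂ, (∀ᶠ x in 𝓝 p, MDifferentiableAt 𝓘(ℂ) 𝓘(ℂ) G x) ∧ G p ≠ 0 ∧
    ∀ᶠ x in 𝓝 p, f x = crd p x * G x

variable {Ω : Set X} {p q : X} {f h : X → ℂ}

theorem norm_eq_of_norm_le {c : ℝ} (hΩ : IsOpen Ω) (hΩc : IsPreconnected Ω)
    (hf : ∀ x ∈ Ω, MDifferentiableAt 𝓘(ℂ) 𝓘(ℂ) f x) (hp : p ∈ Ω) (hpc : ‖f p‖ = c)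
    (hle : ∀ x ∈ Ω, ‖f x‖ ≤ c) : ∀ x ∈ Ω, ‖f x‖ = c := fun x hx ↦ by
  have h1 : MDifferentiableOn 𝓘(ℂ) 𝓘(ℂ) f Ω := fun y hy ↦ (hf y hy).mdifferentiableWithinAt
  have h2 := h1.norm_eqOn_of_isPreconnected_of_isMaxOn hΩc hΩ hp
    (fun y hy ↦ by simpa only [mem_ofPred, Function.comp, hpc] using hle y hy) hx
  exact h2.trans hpc

/-- Schwarz's lemma relative to a Green map. -/
theorem IsGreenMap.exists_factor [T2Space X] (hh : IsGreenMap Ω q h) (hΩ : IsOpen Ω)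
    (hΩc : IsPreconnected Ω) (hΩk : ¬ IsCompact Ω) (hq : q ∈ Ω) {φ : X → ℂ}
    (hφ : ∀ x ∈ Ω, MDifferentiableAt 𝓘(ℂ) 𝓘(ℂ) φ x) (hφ1 : ∀ x ∈ Ω, ‖φ x‖ ≤ 1) (hφq : φ q = 0) :
    ∃ Q : X → ℂ, (∀ x ∈ Ω, MDifferentiableAt 𝓘(ℂ) 𝓘(ℂ) Q x) ∧ (∀ x ∈ Ω, ‖Q x‖ ≤ 1) ∧
      ∀ x ∈ Ω, φ x = Q x * h x := by
  classical
  obtain ⟨G, hG, hGq, hhG⟩ := hh.simple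
  obtain ⟨Φ, hΦ, hφΦ⟩ := exists_eq_crd_mul
    (by filter_upwards [hΩ.mem_nhds hq] with y hy using hφ y hy) hφq
  set Q : X → ℂ := Function.update (fun x ↦ φ x / h x) q (Φ q / G q) with hQ
  have hQne : ∀ x, x ≠ q → Q x = φ x / h x := fun x hx ↦ Function.update_of_ne hx _ _
  have hGne : ∀ᶠ x in 𝓝 q, G x ≠ 0 := hG.self_of_nhds.continuousAt.eventually_ne hGq
  have hdiv : ∀ {a b : X → ℂ} {x : X}, MDifferentiableAt 𝓘(ℂ) 𝓘(ℂ) a x →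
      MDifferentiableAt 𝓘(ℂ) 𝓘(ℂ) b x → b x ≠ 0 →
      MDifferentiableAt 𝓘(ℂ) 𝓘(ℂ) (fun x ↦ a x / b x) x := fun {a b x} ha hb hbx ↦ by
    have h5 : MDifferentiableAt 𝓘(ℂ) 𝓘(ℂ) (fun y ↦ (b y)⁻¹) x :=
      DifferentiableAt.comp_mdifferentiableAt (g := fun w ↦ w⁻¹) (differentiableAt_inv hbx) hb
    simpa only [div_eq_mul_inv] using! ha.mul h5
  have hQd : ∀ x ∈ Ω, MDifferentiableAt 𝓘(ℂ) 𝓘(ℂ) Q x := fun x hx ↦ by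
    by_cases hxq : x = q
    · subst hxq
      refine (hdiv hΦ.self_of_nhds hG.self_of_nhds hGq).congr_of_eventuallyEq ?_
      filter_upwards [hhG, hφΦ, hGne, (crd x).open_source.mem_nhds (mem_crd_source x)]
        with y h1 h2 h3 h4
      by_cases hy : y = x
      · rw [hy, hQ, Function.update_self]
      · have h5 : crd x y ≠ 0 := fun h ↦ hy ((crd_eq_zero_iff h4).1 h)
        rw [hQne y hy, h1, h2, mul_div_mul_left _ _ h5]
    · refine (hdiv (hφ x hx) (hh.mdiff x hx) (hh.ne_zero x hx hxq)).congr_of_eventuallyEq ?_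
      filter_upwards [isOpen_ne.mem_nhds hxq] with y hy using hQne y hy
  have hfac : ∀ x ∈ Ω, φ x = Q x * h x := fun x hx ↦ by
    by_cases hxq : x = q
    · rw [hxq, hφq, hh.map_self, mul_zero]
    · rw [hQne x hxq, div_mul_cancel₀ _ (hh.ne_zero x hx hxq)]
  refine ⟨Q, hQd, fun x₀ hx₀ ↦ ?_, hfac⟩
  by_contra! hlt
  set c := ‖Q x₀‖ with hc
  have hc0 : 0 < c := one_pos.trans hlt
  -- Where `‖Q‖ ≥ c > 1`, the bound on `φ` forces `‖h‖ ≤ c⁻¹`. Properness of `h` then makes `‖Q‖`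
  -- attain its maximum, so it is constant and `Ω` would equal the compact set `S`.
  have hS := hh.proper c⁻¹ (inv_lt_one_of_one_lt₀ hlt)
  set S := {x ∈ Ω | ‖h x‖ ≤ c⁻¹} with hSdef
  have hkey : ∀ x ∈ Ω, c ≤ ‖Q x‖ → x ∈ S := fun x hx hcx ↦ by
    refine ⟨hx, ?_⟩
    have h1 := hφ1 x hx
    rw [hfac x hx, norm_mul] at h1
    rw [← one_div, le_div_iff₀ hc0, mul_comm]
    exact (mul_le_mul_of_nonneg_right hcx (norm_nonneg _)).trans h1
  obtain ⟨x₁, hx₁, hmax⟩ := hS.exists_isMaxOn ⟨x₀, hkey x₀ hx₀ le_rfl⟩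
    (f := fun x ↦ ‖Q x‖) (fun x hx ↦ (hQd x hx.1).continuousAt.norm.continuousWithinAt)
  have h1 : c ≤ ‖Q x₁‖ := hmax (hkey x₀ hx₀ le_rfl)
  have h2 := norm_eq_of_norm_le hΩ hΩc hQd hx₁.1 rfl fun x hx ↦ by
    rcases le_total c ‖Q x‖ with h | h
    · exact hmax (hkey x hx h)
    · exact h.trans h1
  have h3 : S = Ω := Subset.antisymm (fun x hx ↦ hx.1) fun x hx ↦ hkey x hx (h1.trans (h2 x hx).ge)
  exact hΩk (h3 ▸ hS)

omit [IsManifold 𝓘(ℂ) ω X] in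
/-- The Blaschke factor vanishing at `a`, composed with a Green map. -/
theorem IsGreenMap.blaschke (hf : IsGreenMap Ω p f) {a : ℂ} (ha : ‖a‖ < 1) :
    (∀ x ∈ Ω, 1 - starRingEnd ℂ a * f x ≠ 0) ∧
    (∀ x ∈ Ω, MDifferentiableAt 𝓘(ℂ) 𝓘(ℂ)
      (fun x ↦ (f x - a) / (1 - starRingEnd ℂ a * f x)) x) ∧
    ∀ x ∈ Ω, ‖(f x - a) / (1 - starRingEnd ℂ a * f x)‖ ≤ 1 := by
  have hne : ∀ x ∈ Ω, 1 - starRingEnd ℂ a * f x ≠ 0 := fun x hx h0 ↦ by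
    have h1 : ‖starRingEnd ℂ a * f x‖ = 1 := by rw [← sub_eq_zero.1 h0, norm_one]
    rw [norm_mul, RCLike.norm_conj] at h1
    have h2 := hf.norm_lt x hx
    nlinarith [norm_nonneg a, norm_nonneg (f x)]
  refine ⟨hne, fun x hx ↦ ?_, fun x hx ↦ ?_⟩
  · refine DifferentiableAt.comp_mdifferentiableAt
      (g := fun w ↦ (w - a) / (1 - starRingEnd ℂ a * w)) ?_ (hf.mdiff x hx)
    exact DifferentiableAt.div (by fun_prop) (by fun_prop) (hne x hx)
  · have h2 := hf.norm_lt x hx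
    rw [norm_div, div_le_one (norm_pos_iff.2 (hne x hx))]
    refine (sq_le_sq₀ (norm_nonneg _) (norm_nonneg _)).1 ?_
    have ha2 : a.re * a.re + a.im * a.im < 1 := by
      rw [← Complex.normSq_apply, Complex.normSq_eq_norm_sq]
      nlinarith [norm_nonneg a]
    have hw2 : (f x).re * (f x).re + (f x).im * (f x).im < 1 := by
      rw [← Complex.normSq_apply, Complex.normSq_eq_norm_sq]
      nlinarith [norm_nonneg (f x)]
    rw [← Complex.normSq_eq_norm_sq, ← Complex.normSq_eq_norm_sq, Complex.normSq_apply,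
      Complex.normSq_apply]
    simp only [Complex.sub_re, Complex.sub_im, Complex.one_re, Complex.one_im, Complex.mul_re,
      Complex.mul_im, Complex.conj_re, Complex.conj_im]
    nlinarith [mul_pos (sub_pos.2 ha2) (sub_pos.2 hw2)]

variable [T2Space X]

/-- Schwarz's lemma for the Blaschke factor of `f` that vanishes at `q`, with the denominator
cleared; the last clause is its value at `p`, where `f` vanishes. -/
theorem IsGreenMap.exists_blaschke_eq_mul (hf : IsGreenMap Ω p f) (hh : IsGreenMap Ω q h)
    (hΩ : IsOpen Ω) (hΩc : IsPreconnected Ω) (hΩk : ¬ IsCompact Ω) (hp : p ∈ Ω) (hq : q ∈ Ω) :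
    ∃ Q : X → ℂ, (∀ x ∈ Ω, MDifferentiableAt 𝓘(ℂ) 𝓘(ℂ) Q x) ∧ (∀ x ∈ Ω, ‖Q x‖ ≤ 1) ∧
      (∀ x ∈ Ω, f x - f q = Q x * h x * (1 - starRingEnd ℂ (f q) * f x)) ∧
      ‖f q‖ = ‖Q p‖ * ‖h p‖ := by
  obtain ⟨h1, h2, h3⟩ := hf.blaschke (hf.norm_lt q hq)
  obtain ⟨Q, hQ1, hQ2, hQ3⟩ := hh.exists_factor hΩ hΩc hΩk hq h2 h3 (by simp)
  have h4 : ∀ x ∈ Ω, f x - f q = Q x * h x * (1 - starRingEnd ℂ (f q) * f x) := fun x hx ↦ by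
    rw [← hQ3 x hx, div_mul_cancel₀ _ (h1 x hx)]
  refine ⟨Q, hQ1, hQ2, h4, ?_⟩
  have h5 := h4 p hp
  rw [hf.map_self, mul_zero, sub_zero, mul_one, zero_sub] at h5
  rw [← norm_mul, ← h5, norm_neg]

/-- Used in both directions, this is the symmetry of the Green's function. -/
theorem IsGreenMap.norm_apply_le (hf : IsGreenMap Ω p f) (hh : IsGreenMap Ω q h)
    (hΩ : IsOpen Ω) (hΩc : IsPreconnected Ω) (hΩk : ¬ IsCompact Ω) (hp : p ∈ Ω) (hq : q ∈ Ω) :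
    ‖f q‖ ≤ ‖h p‖ := by
  obtain ⟨Q, -, hQ, -, h1⟩ := hf.exists_blaschke_eq_mul hh hΩ hΩc hΩk hp hq
  rw [h1]
  exact mul_le_of_le_one_left (norm_nonneg _) (hQ p hp)

/-- Differences of values of a Green map are governed by the Green map of the other point. -/
theorem IsGreenMap.exists_sub_eq_mul (hf : IsGreenMap Ω p f) (hh : IsGreenMap Ω q h)
    (hΩ : IsOpen Ω) (hΩc : IsPreconnected Ω) (hΩk : ¬ IsCompact Ω) (hp : p ∈ Ω) (hq : q ∈ Ω)
    (hpq : p ≠ q) :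
    ∃ Q : X → ℂ, (∀ x ∈ Ω, MDifferentiableAt 𝓘(ℂ) 𝓘(ℂ) Q x) ∧ (∀ x ∈ Ω, Q x ≠ 0) ∧
      ∀ x ∈ Ω, f x - f q = Q x * h x := by
  obtain ⟨Q, hQ1, hQ2, hQ3, hQ4⟩ := hf.exists_blaschke_eq_mul hh hΩ hΩc hΩk hp hq
  have hhp : 0 < ‖h p‖ := norm_pos_iff.2 (hh.ne_zero p hp hpq)
  -- Exchanging `p` and `q` gives `‖h p‖ ≤ ‖f q‖ = ‖Q p‖ * ‖h p‖`, and `h p ≠ 0`.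
  have hQp : ‖Q p‖ = 1 := by
    have h1 := hh.norm_apply_le hf hΩ hΩc hΩk hq hp
    rw [hQ4] at h1
    exact le_antisymm (hQ2 p hp) (by nlinarith)
  have hQn := norm_eq_of_norm_le hΩ hΩc hQ1 hp hQp hQ2
  refine ⟨fun x ↦ Q x * (1 - starRingEnd ℂ (f q) * f x), fun x hx ↦ (hQ1 x hx).mul ?_,
    fun x hx ↦ mul_ne_zero (fun h0 ↦ ?_) ((hf.blaschke (hf.norm_lt q hq)).1 x hx), fun x hx ↦ ?_⟩
  · exact DifferentiableAt.comp_mdifferentiableAt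
      (g := fun w ↦ 1 - starRingEnd ℂ (f q) * w) (by fun_prop) (hf.mdiff x hx)
  · have := hQn x hx
    rw [h0, norm_zero] at this
    exact zero_ne_one this
  · rw [hQ3 x hx]; ring

/-- Green maps are injective. -/
theorem IsGreenMap.injOn (hf : IsGreenMap Ω p f) (hall : ∀ q ∈ Ω, ∃ h, IsGreenMap Ω q h)
    (hΩ : IsOpen Ω) (hΩc : IsPreconnected Ω) (hΩk : ¬ IsCompact Ω) (hp : p ∈ Ω) :
    InjOn f Ω := by
  intro x hx q hq hxq
  by_cases hpq : p = q
  · subst hpq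
    by_contra hne
    exact hf.ne_zero x hx hne (hxq.trans hf.map_self)
  · obtain ⟨h, hh⟩ := hall q hq
    obtain ⟨Q, -, hQ, hQe⟩ := hf.exists_sub_eq_mul hh hΩ hΩc hΩk hp hq hpq
    have h1 := hQe x hx
    rw [hxq, sub_self] at h1
    by_contra hne
    exact mul_ne_zero (hQ x hx) (hh.ne_zero x hx hne) h1.symm

/-- Green maps are immersions. -/
theorem IsGreenMap.exists_sub_eq_crd_mul (hf : IsGreenMap Ω p f)
    (hall : ∀ q ∈ Ω, ∃ h, IsGreenMap Ω q h) (hΩ : IsOpen Ω) (hΩc : IsPreconnected Ω)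
    (hΩk : ¬ IsCompact Ω) (hp : p ∈ Ω) (hq : q ∈ Ω) :
    ∃ G : X → ℂ, ContinuousAt G q ∧ G q ≠ 0 ∧ ∀ᶠ x in 𝓝 q, f x = f q + crd q x * G x := by
  by_cases hpq : p = q
  · subst hpq
    obtain ⟨G, hG, hGp, hfG⟩ := hf.simple
    refine ⟨G, hG.self_of_nhds.continuousAt, hGp, ?_⟩
    filter_upwards [hfG] with x hx
    rw [hx, hf.map_self, zero_add]
  · obtain ⟨h, hh⟩ := hall q hq
    obtain ⟨Q, hQd, hQ, hQe⟩ := hf.exists_sub_eq_mul hh hΩ hΩc hΩk hp hq hpq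
    obtain ⟨G, hG, hGq, hhG⟩ := hh.simple
    refine ⟨fun x ↦ Q x * G x, (hQd q hq).continuousAt.mul hG.self_of_nhds.continuousAt,
      mul_ne_zero (hQ q hq) hGq, ?_⟩
    filter_upwards [hhG, hΩ.mem_nhds hq] with x hx hxΩ
    rw [← sub_eq_iff_eq_add', hQe x hxΩ, hx]
    ring

end DiscMap

/-! ### From Green maps to a biholomorphism -/

section Diffeo

variable {X : Type*} [TopologicalSpace X] [ChartedSpace ℂ X] [IsManifold 𝓘(ℂ) ω X]

theorem contMDiffAt_crd (q : X) : ContMDiffAt 𝓘(ℂ) 𝓘(ℂ) ω (crd q) q := by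
  have h1 : ContMDiffAt 𝓘(ℂ) 𝓘(ℂ) ω (chartAt ℂ q) q :=
    contMDiffAt_of_mem_maximalAtlas (IsManifold.chart_mem_maximalAtlas q) (mem_chart_source ℂ q)
  have h2 : ContDiff ℂ ω fun w : ℂ ↦ w + -(chartAt ℂ q q) := by fun_prop
  exact h2.contMDiff.contMDiffAt.comp q h1

theorem contMDiffAt_crd_symm (q : X) : ContMDiffAt 𝓘(ℂ) 𝓘(ℂ) ω (crd q).symm 0 := by
  have h1 : ContMDiffAt 𝓘(ℂ) 𝓘(ℂ) ω (chartAt ℂ q).symm (0 + chartAt ℂ q q) := by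
    rw [zero_add]
    exact contMDiffAt_symm_of_mem_maximalAtlas (IsManifold.chart_mem_maximalAtlas q)
      (mem_chart_target ℂ q)
  have h2 : ContDiff ℂ ω fun w : ℂ ↦ w + chartAt ℂ q q := by fun_prop
  have := ContMDiffAt.comp (0 : ℂ) h1 h2.contMDiff.contMDiffAt
  convert this using 1
  ext w
  simp [crd, Homeomorph.addRight, Equiv.addRight]

theorem contDiffAt_comp_crd_symm {f : X → ℂ} {q : X}
    (hf : ∀ᶠ y in 𝓝 q, MDifferentiableAt 𝓘(ℂ) 𝓘(ℂ) f y) :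
    ContDiffAt ℂ ω (f ∘ (crd q).symm) 0 := by
  obtain ⟨s, hs, hso, h0⟩ :=
    _root_.eventually_nhds_iff.1 (eventually_differentiableAt_comp_crd_symm hf)
  have h1 : DifferentiableOn ℂ (f ∘ (crd q).symm) s :=
    fun z hz ↦ (hs z hz).differentiableWithinAt
  exact (h1.analyticAt (hso.mem_nhds h0)).contDiffAt

/-- In a chart, complex differentiability on a neighbourhood is analyticity. -/
theorem contMDiffAt_of_mdifferentiableAt {f : X → ℂ} {q : X}
    (hf : ∀ᶠ y in 𝓝 q, MDifferentiableAt 𝓘(ℂ) 𝓘(ℂ) f y) : ContMDiffAt 𝓘(ℂ) 𝓘(ℂ) ω f q := by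
  have h1 : ContMDiffAt 𝓘(ℂ) 𝓘(ℂ) ω (f ∘ (crd q).symm) (crd q q) := by
    rw [crd_self]
    exact (contDiffAt_comp_crd_symm hf).contMDiffAt
  refine (h1.comp q (contMDiffAt_crd q)).congr_of_eventuallyEq ?_
  filter_upwards [(crd q).open_source.mem_nhds (mem_crd_source q)] with y hy
  simp [(crd q).left_inv hy]

/-- The holomorphic inverse function theorem on a Riemann surface. -/
theorem exists_contMDiffAt_rightInverse {f G : X → ℂ} {q : X}
    (hf : ∀ᶠ y in 𝓝 q, MDifferentiableAt 𝓘(ℂ) 𝓘(ℂ) f y) (hG : ContinuousAt G q) (hGq : G q ≠ 0)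
    (hfG : ∀ᶠ x in 𝓝 q, f x = f q + crd q x * G x) :
    ∃ g : ℂ → X, ContMDiffAt 𝓘(ℂ) 𝓘(ℂ) ω g (f q) ∧ g (f q) = q ∧
      ∀ᶠ w in 𝓝 (f q), f (g w) = w := by
  have hF := contDiffAt_comp_crd_symm hf
  set F := f ∘ (crd q).symm with hFdef
  have h0 := zero_mem_crd_target q
  have hc := (crd q).continuousAt_symm h0
  have hF0 : F 0 = f q := by simp [hFdef, crd_symm_zero]
  -- The slope of `F` at `0` is `G` read in the chart, so continuity of `G` at `q` suffices.
  have hd : HasDerivAt F (G q) 0 := by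
    rw [hasDerivAt_iff_tendsto_slope]
    have h1 : ContinuousAt (G ∘ (crd q).symm) 0 :=
      ContinuousAt.comp (by rwa [crd_symm_zero]) hc
    have h2 : Tendsto (G ∘ (crd q).symm) (𝓝[≠] 0) (𝓝 (G q)) := by
      have := h1.tendsto
      simp only [Function.comp, crd_symm_zero] at this
      exact this.mono_left nhdsWithin_le_nhds
    refine h2.congr' ?_
    have h3 : Tendsto (crd q).symm (𝓝 0) (𝓝 q) := by simpa only [crd_symm_zero] using hc.tendsto
    filter_upwards [nhdsWithin_le_nhds (h3.eventually hfG),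
      nhdsWithin_le_nhds ((crd q).open_target.mem_nhds h0), self_mem_nhdsWithin] with z h4 h5 h6
    rw [slope_def_field, hF0, sub_zero]
    simp only [hFdef, Function.comp]
    rw [h4, (crd q).right_inv h5, add_sub_cancel_left, mul_div_cancel_left₀ _ h6]
  have hd' : HasFDerivAt F
      ((ContinuousLinearEquiv.unitsEquivAut ℂ (Units.mk0 (G q) hGq) : ℂ ≃L[ℂ] ℂ) : ℂ →L[ℂ] ℂ) 0 :=
    hd.hasFDerivAt_equiv hGq
  have hω : (ω : ℕ∞ω) ≠ 0 := by simp
  set L := hF.localInverse hd' hω with hL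
  have hL0 : L (f q) = 0 := by rw [← hF0]; exact hF.localInverse_apply_image hd' hω
  have hLc : ContDiffAt ℂ ω L (f q) := by rw [← hF0]; exact hF.to_localInverse hd' hω
  refine ⟨(crd q).symm ∘ L, ?_, by simp [hL0, crd_symm_zero], ?_⟩
  · refine ContMDiffAt.comp (f q) ?_ hLc.contMDiffAt
    rw [hL0]
    exact contMDiffAt_crd_symm q
  · rw [← hF0]
    exact (hF.hasStrictFDerivAt' hd' hω).eventually_right_inverse

variable [T2Space X]

/-- A domain with a Green map for each of its points is biholomorphic to the disc. -/
theorem exists_diffeomorph_openUnitDisk {Ω : TopologicalSpace.Opens X} {p : X} (hp : p ∈ Ω)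
    (hΩc : IsPreconnected (Ω : Set X)) (hΩk : ¬ IsCompact (Ω : Set X))
    (hall : ∀ q ∈ Ω, ∃ h, IsGreenMap (Ω : Set X) q h) :
    Nonempty (Diffeomorph 𝓘(ℂ) 𝓘(ℂ) Ω openUnitDisk ω) := by
  obtain ⟨f, hf⟩ := hall p hp
  have hfd : ∀ q ∈ Ω, ∀ᶠ y in 𝓝 q, MDifferentiableAt 𝓘(ℂ) 𝓘(ℂ) f y := fun q hq ↦ by
    filter_upwards [Ω.isOpen.mem_nhds hq] with y hy using hf.mdiff y hy
  have hinj := hf.injOn hall Ω.isOpen hΩc hΩk hp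
  have hloc : ∀ q ∈ Ω, ∃ g : ℂ → X, ContMDiffAt 𝓘(ℂ) 𝓘(ℂ) ω g (f q) ∧
      ∀ᶠ w in 𝓝 (f q), g w ∈ Ω ∧ f (g w) = w := fun q hq ↦ by
    obtain ⟨G, hG, hGq, hfG⟩ := hf.exists_sub_eq_crd_mul hall Ω.isOpen hΩc hΩk hp hq
    obtain ⟨g, hg, hgq, hfg⟩ := exists_contMDiffAt_rightInverse (hfd q hq) hG hGq hfG
    refine ⟨g, hg, (hg.continuousAt.eventually_mem ?_).and hfg⟩
    rw [hgq]
    exact Ω.isOpen.mem_nhds hq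
  have hopen : IsOpen (f '' Ω) := by
    refine isOpen_iff_mem_nhds.2 ?_
    rintro _ ⟨q, hq, rfl⟩
    obtain ⟨g, -, hg⟩ := hloc q hq
    filter_upwards [hg] with w hw using ⟨g w, hw.1, hw.2⟩
  have hsub : f '' Ω ⊆ ball 0 1 := by
    rintro _ ⟨q, hq, rfl⟩
    simpa using hf.norm_lt q hq
  have hsurj : ball 0 1 ⊆ f '' Ω := by
    refine (convex_ball (0 : ℂ) 1).isPreconnected.subset_of_closure_inter_subset hopen
      ⟨f p, hsub ⟨p, hp, rfl⟩, p, hp, rfl⟩ ?_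
    rintro w ⟨hwc, hw⟩
    -- Near `w` the image coincides with the image of the compact sublevel set at height `c`, so it
    -- is closed there.
    obtain ⟨c, hwlt, hc1⟩ := exists_between (mem_ball_zero_iff.1 hw)
    have hS := hf.proper c hc1
    have hSc : IsCompact (f '' {x ∈ (Ω : Set X) | ‖f x‖ ≤ c}) :=
      hS.image_of_continuousOn fun x hx ↦ (hf.mdiff x hx.1).continuousAt.continuousWithinAt
    have h1 : w ∈ closure (f '' {x ∈ (Ω : Set X) | ‖f x‖ ≤ c}) := by
      rw [mem_closure_iff_nhds] at hwc ⊢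
      intro t ht
      obtain ⟨_, ⟨ht1, ht2⟩, x, hx, rfl⟩ := hwc (t ∩ ball 0 c)
        (inter_mem ht (isOpen_ball.mem_nhds (by simpa using hwlt)))
      exact ⟨f x, ht1, x, ⟨hx, (mem_ball_zero_iff.1 ht2).le⟩, rfl⟩
    rw [hSc.isClosed.closure_eq] at h1
    obtain ⟨x, hx, rfl⟩ := h1
    exact ⟨x, hx.1, rfl⟩
  choose g hgΩ hfg using fun w : openUnitDisk ↦ hsurj w.2
  refine ⟨⟨⟨fun x ↦ ⟨f x, by exact hsub ⟨x, x.2, rfl⟩⟩, fun w ↦ ⟨g w, hgΩ w⟩, fun x ↦ ?_,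
    fun w ↦ ?_⟩, fun x ↦ ?_, fun w ↦ ?_⟩⟩
  · exact Subtype.ext (hinj (hgΩ _) x.2 (hfg _))
  · exact Subtype.ext (hfg w)
  · refine (ChartedSpace.liftPropWithinAt_subtypeVal_comp_iff ..).1 ?_
    exact contMDiffAt_subtype_iff.2 (contMDiffAt_of_mdifferentiableAt (hfd x x.2))
  · refine (ChartedSpace.liftPropWithinAt_subtypeVal_comp_iff ..).1 ?_
    -- By injectivity the global inverse agrees near `w` with the local holomorphic right inverse
    -- `k`.
    obtain ⟨k, hk, hkw⟩ := hloc (g w) (hgΩ w)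
    rw [hfg w] at hk hkw
    refine ContMDiffAt.congr_of_eventuallyEq (contMDiffAt_subtype_iff.2 hk) ?_
    filter_upwards [continuous_subtype_val.continuousAt.eventually hkw] with v hv
    exact hinj (hgΩ v) hv.1 ((hfg v).trans hv.2.symm)

end Diffeo

/-! ### Green maps of the sub-surface and the conclusion -/

section GreenMapOfSubsurface

variable {X : Type*} [TopologicalSpace X] [ChartedSpace ℂ X] [IsManifold 𝓘(ℂ) ω X] [T2Space X]

/-- The bounds on `f` translate those on `u` through `|f| = exp (-u)`; the strict bound by `1`
follows from the maximum principle and `f p = 0`. -/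
theorem IsSubsurfaceWithSmoothBoundary.exists_isGreenMap [PreconnectedSpace X] {K : Set X}
    (hK : IsSubsurfaceWithSmoothBoundary K) (hKc : IsCompact K)
    [SimplyConnectedSpace (interior K)] (hKb : ∃ ζ ∈ K, ζ ∉ interior K) {p : X}
    (hp : p ∈ interior K) : ∃ f, IsGreenMap (interior K) p f := by
  have hΩc : IsPreconnected (interior K) := isPreconnected_iff_preconnectedSpace.2 inferInstance
  obtain ⟨u, hu, hup, hu0, hub⟩ := hK.exists_green hKc hΩc hKb hp
  obtain ⟨f, hfd, hfu, G, hG, hGp, hfG⟩ := exists_holomorphic_of_green isOpen_interior hp hu hup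
  have hfp : f p = 0 := by rw [hfG.self_of_nhds, crd_self, zero_mul]
  have hf1 : ∀ x ∈ interior K, ‖f x‖ ≤ 1 := fun x hx ↦ by
    by_cases hxp : x = p
    · rw [hxp, hfp, norm_zero]; exact zero_le_one
    · rw [hfu x hx hxp, Real.exp_le_one_iff]
      linarith [hu0 x hx hxp]
  refine ⟨f, hfd, hfp, fun x hx hxp h0 ↦ ?_, fun x hx ↦ (hf1 x hx).lt_of_ne fun h1 ↦ ?_,
    fun c hc ↦ ?_, G, hG, hGp, hfG⟩
  · have := hfu x hx hxp
    rw [h0, norm_zero] at this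
    exact (Real.exp_pos _).ne this
  · have := norm_eq_of_norm_le isOpen_interior hΩc hfd hx h1 hf1 p hp
    rw [hfp, norm_zero] at this
    exact zero_ne_one this
  · refine hKc.of_isClosed_subset ?_ fun x hx ↦ interior_subset hx.1
    rw [← isOpen_compl_iff, isOpen_iff_mem_nhds]
    intro x hx
    by_cases hxK : x ∈ K
    · by_cases hxi : x ∈ interior K
      · have hlt : c < ‖f x‖ := by
          by_contra! h
          exact hx ⟨hxi, h⟩
        filter_upwards [(hfd x hxi).continuousAt.norm.eventually_const_lt hlt] with y hy hyA
        exact hy.not_ge hyA.2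
      · have hev : ∀ᶠ ε : ℝ in 𝓝[>] 0, max c 0 < Real.exp (-ε) := by
          have h1 : Tendsto (fun ε : ℝ ↦ Real.exp (-ε)) (𝓝 0) (𝓝 1) := by
            have : Continuous fun ε : ℝ ↦ Real.exp (-ε) := by fun_prop
            simpa using this.tendsto 0
          exact (h1.mono_left nhdsWithin_le_nhds).eventually_const_lt
            (max_lt hc one_pos)
        obtain ⟨ε, hε, hε0⟩ := (hev.and self_mem_nhdsWithin).exists
        obtain ⟨N, hN, hNu⟩ := hub x hxK hxi ε hε0
        have hxp : x ≠ p := fun h ↦ hxi (h ▸ hp)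
        filter_upwards [hN, isOpen_ne.mem_nhds hxp] with y hy hyp hyA
        have h2 := hfu y hyA.1 hyp
        have h3 : Real.exp (-ε) ≤ Real.exp (-u y) :=
          Real.exp_le_exp.2 (neg_le_neg (hNu y ⟨interior_subset hyA.1, hy⟩))
        have h4 := hyA.2
        have h5 := le_max_left c 0
        linarith
    · filter_upwards [hKc.isClosed.isOpen_compl.mem_nhds hxK] with y hy hyA
      exact hy (interior_subset hyA.1)

end GreenMapOfSubsurface

theorem mainTheorem2 {X : Type*} [TopologicalSpace X] [T2Space X] [ConnectedSpace X]
    [ChartedSpace ℂ X] [IsManifold 𝓘(ℂ) ω X]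
    (K : Set X) (hK_compact : IsCompact K) (hK : IsSubsurfaceWithSmoothBoundary K)
    (hK_simply_connected : SimplyConnectedSpace K)
    (hK_boundary : IsConnected (frontier K)) :
    Nonempty (Diffeomorph 𝓘(ℂ) 𝓘(ℂ) (interiorSurface K) openUnitDisk ω) := by
  have hsc := hK.simplyConnectedSpace_interior hK_compact
  obtain ⟨ζ, hζc, hζi⟩ := hK_boundary.nonempty
  have hζK : ζ ∈ K := hK_compact.isClosed.closure_eq ▸ hζc
  have hΩc : IsPreconnected (interior K) := isPreconnected_iff_preconnectedSpace.2 inferInstance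
  obtain ⟨⟨p, hp⟩⟩ : Nonempty (interior K) := inferInstance
  refine exists_diffeomorph_openUnitDisk (Ω := interiorSurface K) (p := p) hp hΩc (fun hc ↦ ?_)
    fun q hq ↦ hK.exists_isGreenMap hK_compact ⟨ζ, hζK, hζi⟩ hq
  -- A compact interior would be clopen in the connected surface, yet it contains `p` and misses
  -- `ζ`.
  rcases isClopen_iff.1 ⟨hc.isClosed, (interiorSurface K).isOpen⟩ with h | h
  · exact (h ▸ hp : p ∈ (∅ : Set X))
  · exact hζi (show ζ ∈ (interiorSurface K : Set X) from h ▸ mem_univ ζ)
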